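/- For a finite graph $G$, a clique coloring of $G$ is a coloring of its vertices such that no inclusion-maximal clique with at least two vertices is monochromatic, and the clique chromatic number $\chi_c(G)$ is the minimum number of colors in a clique coloring of $G$. Let $G(n,\tfrac12)$ be the random graph on the vertex set $[n]$ in which every pair of vertices is adjacent with probability $\tfrac12$ independently; an event holds with high probability (whp) if its probability tends to $1$ as $n\to\infty$. Then whp $$\tfrac12\log_2 n-(3+o(1))\log_2\ln n\ \leqslant\ \chi_c\left(G(n,\tfrac12)\right)\ \leqslant\ \tfrac12\log_2 n-\left(\tfrac12-o(1)\right)\log_2\ln n,$$ where each $o(1)$ is a deterministic sequence tending to $0$ as $n\to\infty$. Consequently there are constants $a,b>0$ such that whp $$a\ln\ln n\ \leqslant\ \tfrac12\log_2 n-\chi_c\left(G(n,\tfrac12)\right)\ \leqslant\ b\ln\ln n,$$ that is, $\chi_c(G(n,\tfrac12))=\tfrac12\log_2 n-\Theta(\ln\ln n)$ whp, and for every $\varepsilon>0$, whp $$\left(\tfrac12-\varepsilon\right)\log_2 n\ \leqslant\ \chi_c\left(G(n,\tfrac12)\right)\ \leqslant\ \left(\tfrac12+\varepsilon\right)\log_2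 n.$$ -/

import Mathlib

open Filter Topology

/-- A clique coloring: no inclusion-maximal clique with at least two vertices is monochromatic.
(One-vertex cliques are exempt, so that an isolated vertex does not rule out every coloring.) -/
def SimpleGraph.IsCliqueColoring {V κ : Type*} (G : SimpleGraph V) (c : V → κ) : Prop :=
  ∀ K : Set V, Maximal G.IsClique K → K.Nontrivial → ¬ ∃ a : κ, ∀ v ∈ K, c v = a

/-- A finite graph has a clique coloring with finitely many colors, so the minimum below is over
a nonempty set. -/
theorem SimpleGraph.exists_isCliqueColoring {V : Type*} [Finite V] (G : SimpleGraph V) :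
    ∃ k : ℕ, ∃ c : V → Fin k, G.IsCliqueColoring c := by
  obtain ⟨k, ⟨e⟩⟩ := Finite.exists_equiv_fin V
  refine ⟨k, e, fun K _ hK h => ?_⟩
  obtain ⟨a, ha⟩ := h
  obtain ⟨x, hx, y, hy, hxy⟩ := hK
  exact hxy (e.injective ((ha x hx).trans (ha y hy).symm))

/-- The clique chromatic number of a finite graph: the least number of colors in a clique
coloring. -/
noncomputable def SimpleGraph.cliqueChromaticNumber {V : Type*} [Finite V]
    (G : SimpleGraph V) : ℕ :=
  sInf {k : ℕ | ∃ c : V → Fin k, G.IsCliqueColoring c}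

/-- The minimum is attained. -/
theorem SimpleGraph.cliqueChromaticNumber_spec {V : Type*} [Finite V] (G : SimpleGraph V) :
    ∃ c : V → Fin G.cliqueChromaticNumber, G.IsCliqueColoring c :=
  Nat.sInf_mem G.exists_isCliqueColoring

/-- The edge probability `1/2`. -/
noncomputable def edgeProbHalf : unitInterval :=
  ⟨1 / 2, by norm_num, by norm_num⟩

/-- `Whp Q`: the random graph `G(n, 1/2)` on `n` labelled vertices has the property `Q n` with
probability tending to `1` as `n → ∞`. -/
def Whp (Q : (n : ℕ) → SimpleGraph (Fin n) → Prop) : Prop :=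
  Tendsto (fun n : ℕ => SimpleGraph.binomialRandom (Fin n) edgeProbHalf
    {G : SimpleGraph (Fin n) | Q n G}) atTop (𝓝 1)

/-! Write `l` for `ln n`. Graphs are encoded by fair coins on unordered pairs, so every probability
becomes an average over finitely many `0`-`1` assignments.

Upper bound. Fix a set `S` of about `½ log₂ n - (½ - ε) log₂ l` vertices. Give each vertex with a
neighbour in `S` the colour of one such neighbour, and use one extra colour for all others. A clique
in the colour of `v` extends by `v`, so the only danger is a maximal clique with no edge to `S`. The
expected number of these tends to `0`: a clique of size `s` is small enough to be extended by one of
the other vertices when `n / 2 ^ s` exceeds `l ^ (1 + ε)`, and otherwise `s ≥ l` and such cliques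
are too rare (`expected_maximal_cliques_le`).

Lower bound. Let `s` be about `log₂ n` and `p` about `√n log n`. Suppose the vertices have `K`
colours. For each colour choose a vertex with the fewest non-neighbours in that colour. These `K`
vertices have at least `K * (s * p)` common non-neighbours, so some colour class contains `s * p` of
them; by minimality every vertex has at least `s * p` non-neighbours in this class. In such a class
one finds `s` disjoint parts of size `p` such that a random transversal has, in expectation, at most
`1/2` outside vertices adjacent to all of it (`exists_parts`, `two_mul_sum_prod_degree_le`). Hence
at least half of the transversals are undominated. This depends only on edges leaving the parts, so
the edges inside are still random, and Janson's inequality makes one of these transversals a clique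
except with probability `exp (-p² / (8 s³))`, small enough for a union bound over all systems of
parts (`bitProb_no_undominated_clique_le`). Enlarging that clique inside the parts gives a
monochromatic maximal clique. The constant `3` comes from the requirement that `K * s * p * 2 ^ K`,
of order `l³ √n 2 ^ K`, be at most a small multiple of `n`.

Both bounds are proved for fixed `ε`; a diagonal argument turns `ε` into sequences tending to `0`.
-/

theorem dependsOn_prod {E ι : Type*} (s : Finset ι) (S : ι → Set E) (f : ι → (E → Bool) → ℝ)
    (hf : ∀ i ∈ s, DependsOn (f i) (S i)) :
    DependsOn (fun ω => ∏ i ∈ s, f i ω) (⋃ i ∈ s, S i) := fun _ _ h =>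
  Finset.prod_congr rfl fun i hi => hf i hi fun e he => h e (Set.mem_biUnion hi he)

/-! ### Averages and independence for fair coins -/

section Average
variable {E : Type*} [Fintype E] [DecidableEq E]

/-- The average of `f` over all `0`-`1` assignments on `E`. -/
noncomputable def bitAvg (f : (E → Bool) → ℝ) : ℝ := (∑ ω, f ω) / 2 ^ Fintype.card E

open Classical in
/-- The probability of `A` under independent fair coin flips indexed by `E`. -/
noncomputable def bitProb (A : (E → Bool) → Prop) : ℝ := bitAvg fun ω => if A ω then 1 else 0

theorem bitAvg_mono {f g : (E → Bool) → ℝ} (h : ∀ ω, f ω ≤ g ω) : bitAvg f ≤ bitAvg g := by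
  unfold bitAvg; gcongr with ω; exact h ω

theorem bitAvg_const (c : ℝ) : bitAvg (fun _ : E → Bool => c) = c := by
  simp [bitAvg]

theorem bitAvg_nonneg {f : (E → Bool) → ℝ} (h : ∀ ω, 0 ≤ f ω) : 0 ≤ bitAvg f := by
  simpa [bitAvg_const] using bitAvg_mono h

theorem bitAvg_add (f g : (E → Bool) → ℝ) :
    bitAvg (fun ω => f ω + g ω) = bitAvg f + bitAvg g := by
  simp [bitAvg, Finset.sum_add_distrib, add_div]

theorem bitAvg_const_mul (c : ℝ) (f : (E → Bool) → ℝ) :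
    bitAvg (fun ω => c * f ω) = c * bitAvg f := by
  simp [bitAvg, ← Finset.mul_sum, mul_div_assoc]

theorem bitAvg_sub (f g : (E → Bool) → ℝ) :
    bitAvg (fun ω => f ω - g ω) = bitAvg f - bitAvg g := by
  simp [bitAvg, Finset.sum_sub_distrib, sub_div]

theorem bitAvg_sum {ι : Type*} (s : Finset ι) (f : ι → (E → Bool) → ℝ) :
    bitAvg (fun ω => ∑ i ∈ s, f i ω) = ∑ i ∈ s, bitAvg (f i) := by
  simp only [bitAvg]
  rw [Finset.sum_comm, Finset.sum_div]

theorem bitProb_nonneg (A : (E → Bool) → Prop) : 0 ≤ bitProb A :=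
  bitAvg_nonneg fun ω => by split_ifs <;> norm_num

theorem bitProb_mono {A B : (E → Bool) → Prop} (h : ∀ ω, A ω → B ω) : bitProb A ≤ bitProb B := by
  refine bitAvg_mono fun ω => ?_
  by_cases ha : A ω
  · simp [ha, h ω ha]
  · simp only [ha, if_false]; split_ifs <;> norm_num

theorem bitProb_le_bitAvg {A : (E → Bool) → Prop} {f : (E → Bool) → ℝ} (h0 : ∀ ω, 0 ≤ f ω)
    (h : ∀ ω, A ω → 1 ≤ f ω) : bitProb A ≤ bitAvg f := by
  refine bitAvg_mono fun ω => ?_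
  split_ifs with ha
  · exact h ω ha
  · exact h0 ω

theorem bitProb_or_le (A B : (E → Bool) → Prop) :
    bitProb (fun ω => A ω ∨ B ω) ≤ bitProb A + bitProb B := by
  unfold bitProb
  rw [← bitAvg_add]
  refine bitAvg_mono fun ω => ?_
  by_cases ha : A ω <;> by_cases hb : B ω <;> simp [ha, hb]

theorem bitProb_exists_le {ι : Type*} (s : Finset ι) (A : ι → (E → Bool) → Prop) :
    bitProb (fun ω => ∃ i ∈ s, A i ω) ≤ ∑ i ∈ s, bitProb (A i) := by
  classical
  have h := bitAvg_sum s (fun i ω => if A i ω then (1 : ℝ) else 0)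
  have h' : ∑ i ∈ s, bitProb (A i) = bitAvg fun ω => ∑ i ∈ s, if A i ω then (1 : ℝ) else 0 := by
    rw [h]; refine Finset.sum_congr rfl fun i _ => ?_
    unfold bitProb; congr
  rw [h']
  refine bitProb_le_bitAvg (fun ω => Finset.sum_nonneg fun i _ => by split_ifs <;> norm_num) ?_
  rintro ω ⟨i, hi, hA⟩
  have := Finset.single_le_sum (f := fun i => if A i ω then (1 : ℝ) else 0)
    (fun i _ => by split_ifs <;> norm_num) hi
  simpa [hA] using this

/-- Resampling the coordinates in `S` does not change the average. -/
theorem bitAvg_piecewise (S : Finset E) (f : (E → Bool) → ℝ) :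
    bitAvg f = bitAvg fun ω' => bitAvg fun ω => f (S.piecewise ω ω') := by
  have key : ∑ x : (E → Bool) × (E → Bool), f (S.piecewise x.2 x.1) =
      ∑ x : (E → Bool) × (E → Bool), f x.2 := by
    -- Exchanging the `S`-coordinates of two independent copies is an involution on pairs of
    -- assignments.
    refine Finset.sum_nbij' (fun x => (S.piecewise x.1 x.2, S.piecewise x.2 x.1))
      (fun x => (S.piecewise x.1 x.2, S.piecewise x.2 x.1)) (by simp) (by simp) ?_ ?_ (by simp)
    all_goals
      rintro ⟨a, b⟩ _
      ext e <;> by_cases he : e ∈ S <;> simp [he]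
  rw [Fintype.sum_prod_type, Fintype.sum_prod_type] at key
  simp only [bitAvg, ← Finset.sum_div]
  rw [key]
  simp

theorem bitAvg_mul_of_dependsOn {S T : Set E} (hST : Disjoint S T) {f g : (E → Bool) → ℝ}
    (hf : DependsOn f S) (hg : DependsOn g T) :
    bitAvg (fun ω => f ω * g ω) = bitAvg f * bitAvg g := by
  classical
  rw [bitAvg_piecewise S.toFinite.toFinset, mul_comm, ← bitAvg_const_mul (E := E)]
  rw [show (fun ω => bitAvg g * f ω) = fun ω => f ω * bitAvg g from funext fun ω => mul_comm _ _]
  have : ∀ ω' ω : E → Bool, f (S.toFinite.toFinset.piecewise ω ω') *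
      g (S.toFinite.toFinset.piecewise ω ω') = f ω * g ω' := by
    intro ω' ω
    congr 1
    · exact hf fun i hi => by simp [hi]
    · exact hg fun i hi => by
        have : i ∉ S := fun h => Set.disjoint_left.1 hST h hi
        simp [this]
  simp only [this]
  have h2 : ∀ ω' : E → Bool, bitAvg (fun ω => f ω * g ω') = bitAvg f * g ω' := fun ω' => by
    rw [mul_comm, ← bitAvg_const_mul]; simp only [mul_comm]
  simp only [h2]
  rw [bitAvg_const_mul, mul_comm, ← bitAvg_const_mul]; simp only [mul_comm]

theorem bitAvg_prod {ι : Type*} (s : Finset ι) (S : ι → Set E) (f : ι → (E → Bool) → ℝ)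
    (hf : ∀ i ∈ s, DependsOn (f i) (S i)) (hS : (s : Set ι).PairwiseDisjoint S) :
    bitAvg (fun ω => ∏ i ∈ s, f i ω) = ∏ i ∈ s, bitAvg (f i) := by
  classical
  induction s using Finset.induction_on with
  | empty => simp [bitAvg_const]
  | insert a s ha ih =>
    simp only [Finset.prod_insert ha]
    rw [bitAvg_mul_of_dependsOn (S := S a) (T := ⋃ i ∈ s, S i), ih]
    · exact fun i hi => hf i (Finset.mem_insert_of_mem hi)
    · exact hS.subset (by simp)
    · rw [Set.disjoint_iUnion₂_right]
      intro i hi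
      exact hS (by simp) (by simp [hi]) (fun h => ha (h ▸ hi))
    · exact hf a (by simp)
    · exact dependsOn_prod s S f fun i hi => hf i (Finset.mem_insert_of_mem hi)

theorem bitAvg_coord (e : E) (h : Bool → ℝ) :
    bitAvg (fun ω => h (ω e)) = (h true + h false) / 2 := by
  -- Written as a product over all coordinates, the sum over assignments factors.
  have h1 : ∀ ω : E → Bool, h (ω e) = ∏ i, (if i = e then h (ω i) else 1) := by
    intro ω; simp
  have h2 := Finset.prod_univ_sum (fun _ : E => (Finset.univ : Finset Bool))
    (fun i b => if i = e then h b else (1 : ℝ))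
  unfold bitAvg
  simp only [h1]
  rw [Fintype.piFinset_univ] at h2
  rw [← h2]
  have h3 : ∀ i : E, (∑ b : Bool, if i = e then h b else (1 : ℝ)) =
      2 * if i = e then (h true + h false) / 2 else 1 := by
    intro i; split_ifs
    · simp; ring
    · simp
  simp only [h3, Finset.prod_mul_distrib]
  simp

theorem bitAvg_prod_coord {ι : Type*} (s : Finset ι) (e : ι → E) (he : Set.InjOn e s)
    (h : Bool → ℝ) :
    bitAvg (fun ω => ∏ i ∈ s, h (ω (e i))) = ((h true + h false) / 2) ^ s.card := by
  rw [bitAvg_prod s (fun i => {e i}) (fun i ω => h (ω (e i)))]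
  · simp [bitAvg_coord, div_pow]
  · intro i _ x y hxy; simp [hxy (e i) rfl]
  · intro i hi j hj hij
    exact Set.disjoint_singleton.2 fun h => hij (he hi hj h)

end Average

/-! ### Harris' and Janson's inequalities -/

section Janson
variable {E : Type*} [Fintype E] [DecidableEq E]

/-- The indicator that all coins in `S` show `true`. -/
noncomputable def allTrue (S : Finset E) (ω : E → Bool) : ℝ := if ∀ e ∈ S, ω e = true then 1 else 0

theorem allTrue_nonneg (S : Finset E) (ω : E → Bool) : 0 ≤ allTrue S ω := by
  unfold allTrue; split_ifs <;> norm_num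

theorem allTrue_mul (S T : Finset E) (ω : E → Bool) :
    allTrue S ω * allTrue T ω = allTrue (S ∪ T) ω := by
  simp only [allTrue, Finset.mem_union, or_imp, forall_and]
  split_ifs <;> simp_all

theorem allTrue_mono (S : Finset E) : Monotone (allTrue S) := by
  intro a b hab
  unfold allTrue
  split_ifs with h1 h2 h2
  · rfl
  · exact absurd (fun e he => by have := hab e; rw [h1 e he] at this; exact top_le_iff.1 this) h2
  · norm_num
  · rfl

theorem allTrue_eq_prod (S : Finset E) (ω : E → Bool) :
    allTrue S ω = ∏ e ∈ S, if ω e = true then (1 : ℝ) else 0 := by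
  rw [allTrue, Finset.prod_ite_zero]; simp

theorem bitAvg_allTrue (S : Finset E) : bitAvg (allTrue S) = (1 / 2) ^ S.card := by
  have := bitAvg_prod_coord S id (Set.injOn_id _) (fun b => if b = true then (1 : ℝ) else 0)
  simp only [id] at this
  rw [show allTrue S = fun ω => ∏ e ∈ S, if ω e = true then (1 : ℝ) else 0 from
    funext (allTrue_eq_prod S), this]
  norm_num

theorem dependsOn_allTrue (S : Finset E) : DependsOn (allTrue S) (S : Set E) := by
  intro x y h
  rw [allTrue_eq_prod, allTrue_eq_prod]
  exact Finset.prod_congr rfl fun e he => by rw [h e he]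

theorem allTrue_supermodular (S : Finset E) (a b : E → Bool) :
    allTrue S a * allTrue S b ≤ allTrue S (a ⊓ b) * allTrue S (a ⊔ b) := by
  by_cases ha : ∀ e ∈ S, a e = true
  · by_cases hb : ∀ e ∈ S, b e = true
    · have h1 : ∀ e ∈ S, (a ⊓ b) e = true := fun e he => by simp [ha e he, hb e he]
      have h2 : ∀ e ∈ S, (a ⊔ b) e = true := fun e he => by simp [ha e he]
      simp only [allTrue, if_pos ha, if_pos hb, if_pos h1, if_pos h2]; norm_num
    · simp only [allTrue, if_neg hb, mul_zero]
      exact mul_nonneg (allTrue_nonneg _ _) (allTrue_nonneg _ _)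
  · simp only [allTrue, if_neg ha, zero_mul]
    exact mul_nonneg (allTrue_nonneg _ _) (allTrue_nonneg _ _)

/-- Harris' inequality conditioned on all coins in `S` showing `true`, for decreasing functions. -/
theorem bitAvg_allTrue_mul_antitone (S : Finset E) {f g : (E → Bool) → ℝ} (hf0 : 0 ≤ f)
    (hg0 : 0 ≤ g) (hf : Antitone f) (hg : Antitone g) :
    bitAvg (fun ω => allTrue S ω * f ω) * bitAvg (fun ω => allTrue S ω * g ω) ≤
      bitAvg (allTrue S) * bitAvg (fun ω => allTrue S ω * (f ω * g ω)) := by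
  have h := fkg (α := (E → Bool)ᵒᵈ) (μ := fun a => allTrue S (OrderDual.ofDual a))
    (f := fun a => f (OrderDual.ofDual a)) (g := fun a => g (OrderDual.ofDual a))
    (fun a => allTrue_nonneg _ _) (fun a => hf0 _) (fun a => hg0 _)
    (fun a b hab => hf hab) (fun a b hab => hg hab)
    (fun a b => by
      have := allTrue_supermodular S (OrderDual.ofDual a) (OrderDual.ofDual b)
      rw [mul_comm (allTrue S (_ ⊓ _))] at this
      exact this)
  have h' : (∑ a, allTrue S a * f a) * (∑ a, allTrue S a * g a) ≤
    (∑ a, allTrue S a) * ∑ a, allTrue S a * (f a * g a) := h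
  unfold bitAvg
  rw [div_mul_div_comm, div_mul_div_comm]
  gcongr

variable {J : Type*} (F : Finset J) (S : J → Finset E)

/-- Split the sum in the exponent as `Y + Z`, where `Z` collects the sets disjoint from `S j`. Given
that all coins in `S j` show `true`, `exp (-tY)` and `exp (-tZ)` are decreasing, so Harris separates
them; `Z` is independent of the conditioning, and `exp (-tY) ≥ 1 - tY` gives the bracket. -/
theorem janson_term (j : J) (t : ℝ) (ht : 0 ≤ t) :
    (bitAvg (allTrue (S j)) - t * ∑ l ∈ F with ¬ Disjoint (S j) (S l),
      bitAvg (allTrue (S j ∪ S l))) * bitAvg (fun ω => Real.exp (-t * ∑ l ∈ F, allTrue (S l) ω)) ≤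
    bitAvg (fun ω => allTrue (S j) ω * Real.exp (-t * ∑ l ∈ F, allTrue (S l) ω)) := by
  classical
  set Y : (E → Bool) → ℝ := fun ω => ∑ l ∈ F with ¬ Disjoint (S j) (S l), allTrue (S l) ω with hY
  set Z : (E → Bool) → ℝ := fun ω => ∑ l ∈ F with Disjoint (S j) (S l), allTrue (S l) ω with hZ
  have hYZ : ∀ ω, ∑ l ∈ F, allTrue (S l) ω = Y ω + Z ω := fun ω => by
    rw [hY, hZ, add_comm]; exact (Finset.sum_filter_add_sum_filter_not _ _ _).symm
  have hanti : ∀ (A : Finset J), Antitone fun ω : E → Bool =>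
      Real.exp (-t * ∑ l ∈ A, allTrue (S l) ω) := fun A a b hab => by
    apply Real.exp_le_exp.2
    have := Finset.sum_le_sum (s := A) fun l _ => allTrue_mono (S l) hab
    nlinarith
  have hharris := bitAvg_allTrue_mul_antitone (S j)
    (f := fun ω => Real.exp (-t * Y ω)) (g := fun ω => Real.exp (-t * Z ω))
    (fun ω => (Real.exp_pos _).le) (fun ω => (Real.exp_pos _).le) (hanti _) (hanti _)
  have hindep : bitAvg (fun ω => allTrue (S j) ω * Real.exp (-t * Z ω)) =
      bitAvg (allTrue (S j)) * bitAvg fun ω => Real.exp (-t * Z ω) := by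
    refine bitAvg_mul_of_dependsOn (S := (S j : Set E)) (T := (S j : Set E)ᶜ) disjoint_compl_right
      (dependsOn_allTrue _) fun x y hxy => ?_
    have : Z x = Z y := Finset.sum_congr rfl fun l hl => dependsOn_allTrue _ fun e he => hxy e ?_
    · rw [this]
    · intro h
      exact Finset.disjoint_left.1 (Finset.mem_filter.1 hl).2 (by simpa using h) (by simpa using he)
  have hp : 0 < bitAvg (allTrue (S j)) := by rw [bitAvg_allTrue]; positivity
  rw [hindep] at hharris
  have h1 : bitAvg (fun ω => allTrue (S j) ω * Real.exp (-t * Y ω)) *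
      (bitAvg fun ω => Real.exp (-t * Z ω)) ≤
      bitAvg fun ω => allTrue (S j) ω * (Real.exp (-t * Y ω) * Real.exp (-t * Z ω)) :=
    le_of_mul_le_mul_left (by linarith) hp
  have h2 : bitAvg (allTrue (S j)) - t * ∑ l ∈ F with ¬ Disjoint (S j) (S l),
      bitAvg (allTrue (S j ∪ S l)) ≤
      bitAvg (fun ω => allTrue (S j) ω * Real.exp (-t * Y ω)) := by
    rw [← bitAvg_sum, ← bitAvg_const_mul, ← bitAvg_sub]
    refine bitAvg_mono fun ω => ?_
    have h3 : ∑ l ∈ F with ¬ Disjoint (S j) (S l), allTrue (S j ∪ S l) ω =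
        allTrue (S j) ω * Y ω := by
      rw [hY, Finset.mul_sum]
      exact Finset.sum_congr rfl fun l _ => (allTrue_mul _ _ _).symm
    rw [h3]
    have := Real.add_one_le_exp (-t * Y ω)
    nlinarith [allTrue_nonneg (S j) ω]
  have h4 : bitAvg (fun ω => Real.exp (-t * ∑ l ∈ F, allTrue (S l) ω)) ≤
      bitAvg fun ω => Real.exp (-t * Z ω) := by
    refine bitAvg_mono fun ω => Real.exp_le_exp.2 ?_
    rw [hYZ]
    have : 0 ≤ Y ω := Finset.sum_nonneg fun l _ => allTrue_nonneg _ _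
    nlinarith
  have h5 : 0 ≤ bitAvg (fun ω => Real.exp (-t * ∑ l ∈ F, allTrue (S l) ω)) :=
    bitAvg_nonneg fun ω => (Real.exp_pos _).le
  have h6 : 0 ≤ bitAvg (fun ω => allTrue (S j) ω * Real.exp (-t * Y ω)) :=
    bitAvg_nonneg fun ω => mul_nonneg (allTrue_nonneg _ _) (Real.exp_pos _).le
  calc _ ≤ bitAvg (fun ω => allTrue (S j) ω * Real.exp (-t * Y ω)) *
        bitAvg (fun ω => Real.exp (-t * ∑ l ∈ F, allTrue (S l) ω)) := by gcongr
    _ ≤ bitAvg (fun ω => allTrue (S j) ω * Real.exp (-t * Y ω)) *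
        bitAvg (fun ω => Real.exp (-t * Z ω)) := by gcongr
    _ ≤ _ := h1.trans (le_of_eq ?_)
  congr 1
  funext ω
  rw [hYZ, ← Real.exp_add]; ring_nf

/-- Janson's inequality for the uniform measure. -/
theorem janson (D : ℝ)
    (hD : ∑ j ∈ F, ∑ l ∈ F with ¬ Disjoint (S j) (S l), (1 / 2 : ℝ) ^ (S j ∪ S l).card ≤ D)
    (hDpos : 0 < D) :
    bitProb (fun ω => ∀ j ∈ F, ¬ ∀ e ∈ S j, ω e = true) ≤
      Real.exp (-(∑ j ∈ F, (1 / 2 : ℝ) ^ (S j).card) ^ 2 / (2 * D)) := by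
  set m : ℝ := ∑ j ∈ F, (1 / 2 : ℝ) ^ (S j).card with hm
  set X : (E → Bool) → ℝ := fun ω => ∑ l ∈ F, allTrue (S l) ω with hX
  set φ : ℝ → ℝ := fun t => bitAvg fun ω => Real.exp (-t * X ω) with hφ
  have hφ0 : ∀ t, 0 ≤ φ t := fun t => bitAvg_nonneg fun ω => (Real.exp_pos _).le
  have hderiv : ∀ t, HasDerivAt φ (-bitAvg fun ω => X ω * Real.exp (-t * X ω)) t := by
    intro t
    have h : HasDerivAt (fun t => (∑ ω, Real.exp (-t * X ω)) / 2 ^ Fintype.card E)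
        ((∑ ω, Real.exp (-t * X ω) * (-1 * X ω)) / 2 ^ Fintype.card E) t := by
      refine HasDerivAt.div_const (HasDerivAt.fun_sum fun ω _ => ?_) _
      exact (((hasDerivAt_id t).neg).mul_const _).exp
    refine h.congr_deriv ?_
    simp only [bitAvg, ← neg_div, ← Finset.sum_neg_distrib]
    congr 1
    exact Finset.sum_congr rfl fun ω _ => by ring
  have hineq : ∀ t, 0 ≤ t → (m - t * D) * φ t ≤ bitAvg fun ω => X ω * Real.exp (-t * X ω) := by
    intro t ht
    have h1 := Finset.sum_le_sum (s := F) fun j _ => janson_term F S j t ht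
    rw [← Finset.sum_mul, ← bitAvg_sum, Finset.sum_sub_distrib, ← Finset.mul_sum] at h1
    simp only [bitAvg_allTrue, ← Finset.sum_mul] at h1
    refine le_trans ?_ h1
    gcongr
    exact hφ0 t
  -- The sum of the terms gives `-φ' ≥ (m - t D) φ`. Multiplication by the integrating factor makes
  -- this a decreasing function with value `1` at `0`; evaluation at the optimal `t = m / D` gives
  -- the bound.
  set ψ : ℝ → ℝ := fun t => φ t * Real.exp (m * t - D * t ^ 2 / 2) with hψ
  have hψd : ∀ t, HasDerivAt ψ ((-bitAvg fun ω => X ω * Real.exp (-t * X ω)) *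
      Real.exp (m * t - D * t ^ 2 / 2) + φ t * (Real.exp (m * t - D * t ^ 2 / 2) *
        (m - D * t))) t := by
    intro t
    refine (hderiv t).mul (HasDerivAt.exp ?_)
    have h := ((hasDerivAt_id t).const_mul m).sub (((hasDerivAt_pow 2 t).const_mul D).div_const 2)
    exact h.congr_deriv (by norm_num; ring)
  have hanti : AntitoneOn ψ (Set.Ici 0) := by
    refine antitoneOn_of_deriv_nonpos (convex_Ici 0)
      (fun t _ => (hψd t).continuousAt.continuousWithinAt)
      (fun t _ => (hψd t).differentiableAt.differentiableWithinAt) fun t ht => ?_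
    rw [interior_Ici] at ht
    rw [(hψd t).deriv]
    have := hineq t (le_of_lt ht)
    have he := Real.exp_pos (m * t - D * t ^ 2 / 2)
    nlinarith
  have hm0 : 0 ≤ m := Finset.sum_nonneg fun j _ => by positivity
  have hT : 0 ≤ m / D := by positivity
  have h := hanti (Set.mem_Ici.2 le_rfl) (Set.mem_Ici.2 hT) hT
  have hψ0 : ψ 0 = 1 := by simp [hψ, hφ, bitAvg_const]
  rw [hψ0] at h
  have hle : bitProb (fun ω => ∀ j ∈ F, ¬ ∀ e ∈ S j, ω e = true) ≤ φ (m / D) := by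
    refine bitProb_le_bitAvg (fun ω => (Real.exp_pos _).le) fun ω hω => ?_
    have : X ω = 0 := Finset.sum_eq_zero fun j hj => by rw [allTrue, if_neg (hω j hj)]
    simp [this]
  refine hle.trans ?_
  have h2 : m * (m / D) - D * (m / D) ^ 2 / 2 = m ^ 2 / (2 * D) := by field_simp; ring
  simp only [hψ] at h
  rw [h2] at h
  rw [neg_div, Real.exp_neg]
  rwa [← le_div_iff₀ (Real.exp_pos _), one_div] at h

end Janson

/-! ### Graphs encoded by coins on pairs -/

/-- The graph whose edges are the non-diagonal pairs marked `true`. -/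
def bitGraph {V : Type*} (ω : Sym2 V → Bool) : SimpleGraph V where
  Adj u v := u ≠ v ∧ ω s(u, v) = true
  symm := ⟨fun u v h => ⟨h.1.symm, by rw [Sym2.eq_swap]; exact h.2⟩⟩
  loopless := ⟨fun _ h => h.1 rfl⟩

/-- The pairs of distinct elements of `K`. -/
def pairs {V : Type*} [DecidableEq V] (K : Finset V) : Finset (Sym2 V) :=
  K.offDiag.image fun x => s(x.1, x.2)

section Pairs
variable {V : Type*} [DecidableEq V]

theorem mem_pairs {K : Finset V} {u v : V} : s(u, v) ∈ pairs K ↔ u ∈ K ∧ v ∈ K ∧ u ≠ v := by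
  simp only [pairs, Finset.mem_image, Finset.mem_offDiag, Prod.exists, Sym2.eq_iff]
  constructor
  · rintro ⟨a, b, ⟨ha, hb, hab⟩, ⟨rfl, rfl⟩ | ⟨rfl, rfl⟩⟩
    · exact ⟨ha, hb, hab⟩
    · exact ⟨hb, ha, hab.symm⟩
  · rintro ⟨hu, hv, h⟩
    exact ⟨u, v, ⟨hu, hv, h⟩, Or.inl ⟨rfl, rfl⟩⟩

theorem card_pairs (K : Finset V) : (pairs K).card = K.card.choose 2 :=
  Sym2.card_image_offDiag K

theorem pairs_inter (K L : Finset V) : pairs K ∩ pairs L = pairs (K ∩ L) := by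
  ext e
  induction e with | _ u v
  simp only [Finset.mem_inter, mem_pairs]; tauto

theorem forall_pairs_iff_isClique (K : Finset V) (ω : Sym2 V → Bool) :
    (∀ e ∈ pairs K, ω e = true) ↔ (bitGraph ω).IsClique K := by
  constructor
  · intro h u hu v hv huv
    exact ⟨huv, h _ (mem_pairs.2 ⟨hu, hv, huv⟩)⟩
  · intro h e
    induction e with | _ u v
    intro he
    obtain ⟨hu, hv, huv⟩ := mem_pairs.1 he
    exact (h hu hv huv).2

theorem pairs_not_disjoint {K L : Finset V} :
    ¬ Disjoint (pairs K) (pairs L) ↔ 2 ≤ (K ∩ L).card := by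
  rw [Finset.disjoint_iff_inter_eq_empty, pairs_inter, ← Finset.card_eq_zero, card_pairs,
    Nat.choose_eq_zero_iff, not_lt]

end Pairs

/-! ### Cliques among the transversals of a system of parts -/

section Transversal
variable {V ι : Type*} [DecidableEq V] [Fintype ι] {p : ℕ}

/-- The vertex set of a transversal of a system of parts of size `p`. -/
def transversal (x : ι × Fin p → V) (y : ι → Fin p) : Finset V :=
  Finset.univ.image fun i => x (i, y i)

theorem card_transversal {x : ι × Fin p → V} (hx : Function.Injective x) (y : ι → Fin p) :
    (transversal x y).card = Fintype.card ι := by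
  rw [transversal, Finset.card_image_of_injective, Finset.card_univ]
  intro i j h
  exact (Prod.ext_iff.1 (hx h)).1

theorem card_transversal_inter {x : ι × Fin p → V} (hx : Function.Injective x)
    (y z : ι → Fin p) :
    (transversal x y ∩ transversal x z).card = (Finset.univ.filter fun i => y i = z i).card := by
  have : transversal x y ∩ transversal x z =
      (Finset.univ.filter fun i => y i = z i).image fun i => x (i, y i) := by
    ext v
    simp only [transversal, Finset.mem_inter, Finset.mem_image, Finset.mem_univ, true_and,
      Finset.mem_filter]
    constructor
    · rintro ⟨⟨i, rfl⟩, ⟨j, hj⟩⟩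
      obtain ⟨h1, h2⟩ := Prod.ext_iff.1 (hx hj)
      simp only at h1 h2
      subst h1
      exact ⟨j, h2.symm, rfl⟩
    · rintro ⟨i, hi, rfl⟩
      exact ⟨⟨i, rfl⟩, ⟨i, by rw [hi]⟩⟩
  rw [this, Finset.card_image_of_injective]
  intro i j h
  exact (Prod.ext_iff.1 (hx h)).1

variable [DecidableEq ι]

theorem card_agree_on (y : ι → Fin p) (A : Finset ι) :
    (Finset.univ.filter fun z : ι → Fin p => ∀ i ∈ A, y i = z i).card =
      p ^ (Fintype.card ι - A.card) := by
  have : (Finset.univ.filter fun z : ι → Fin p => ∀ i ∈ A, y i = z i) =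
      Fintype.piFinset fun i => if i ∈ A then {y i} else Finset.univ := by
    ext z
    simp only [Finset.mem_filter, Finset.mem_univ, true_and, Fintype.mem_piFinset]
    refine forall_congr' fun i => ?_
    by_cases h : i ∈ A <;> simp [h, eq_comm]
  rw [this, Fintype.card_piFinset]
  have h2 : ∀ i, (if i ∈ A then ({y i} : Finset (Fin p)) else Finset.univ).card =
      if i ∈ A then 1 else p := fun i => by split_ifs <;> simp
  simp only [h2]
  rw [Finset.prod_ite]
  simp only [Finset.prod_const, one_pow, one_mul]
  congr 1
  rw [← Finset.card_compl]
  congr 1; ext i; simp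

/-- Among the overlaps of size `j ≥ 2`, size `2` is the worst up to a factor `2`. With `j = i + 2`
the squared ratio is at most four times a product of `i` factors `s² 2 ^ (i + 3) / p²`, each at most
`1` since `i + 3 ≤ s + 1`. This is what forces `p` to be of order `s 2 ^ (s / 2)`. -/
theorem pow_mul_two_pow_choose_le {s p j : ℕ} (hp : s ^ 2 * 2 ^ (s + 1) ≤ p ^ 2) (hj : 2 ≤ j)
    (hjs : j ≤ s) : s ^ j * 2 ^ j.choose 2 * p ^ (s - j) ≤ 2 * s ^ 2 * p ^ (s - 2) := by
  obtain ⟨i, rfl⟩ := Nat.exists_eq_add_of_le' hj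
  have hc : (i + 2).choose 2 * 2 = i * (i + 3) + 2 := by
    rw [Nat.choose_two_right, Nat.div_mul_cancel]
    · simp; ring
    · exact (Nat.even_mul_pred_self (i + 2)).two_dvd
  have h : s ^ i * 2 ^ (i + 2).choose 2 ≤ 2 * p ^ i := by
    refine (Nat.pow_le_pow_iff_left two_ne_zero).1 ?_
    calc (s ^ i * 2 ^ (i + 2).choose 2) ^ 2 = 4 * (s ^ 2 * 2 ^ (i + 3)) ^ i := by
          rw [mul_pow, mul_pow, ← pow_mul 2, hc, pow_add, ← pow_mul, ← pow_mul, ← pow_mul]; ring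
      _ ≤ 4 * (s ^ 2 * 2 ^ (s + 1)) ^ i :=
          Nat.mul_le_mul_left _ (Nat.pow_le_pow_left (Nat.mul_le_mul_left _
            (Nat.pow_le_pow_right (by norm_num) (by omega))) i)
      _ ≤ 4 * (p ^ 2) ^ i := by gcongr
      _ = _ := by rw [mul_pow, ← pow_mul, ← pow_mul]; ring
  calc s ^ (i + 2) * 2 ^ (i + 2).choose 2 * p ^ (s - (i + 2))
      = s ^ 2 * (s ^ i * 2 ^ (i + 2).choose 2) * p ^ (s - (i + 2)) := by ring
    _ ≤ s ^ 2 * (2 * p ^ i) * p ^ (s - (i + 2)) := by gcongr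
    _ = 2 * s ^ 2 * p ^ (i + (s - (i + 2))) := by rw [pow_add]; ring
    _ = _ := by congr 2; omega

/-- This controls the correlation sum in Janson's inequality: two transversals sharing `j` vertices
share `j.choose 2` pairs. The exact agreement set is replaced by a sum over all sets on which `y`
and `z` agree, which is easily counted. -/
theorem sum_two_pow_agree_le (y : ι → Fin p)
    (hp : Fintype.card ι ^ 2 * 2 ^ (Fintype.card ι + 1) ≤ p ^ 2) :
    ∑ z : ι → Fin p with 2 ≤ (Finset.univ.filter fun i => y i = z i).card,
      2 ^ (Finset.univ.filter fun i => y i = z i).card.choose 2 ≤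
      2 * Fintype.card ι ^ 3 * p ^ (Fintype.card ι - 2) := by
  set s := Fintype.card ι with hs
  set P := (Finset.univ : Finset (Finset ι)).filter fun A => 2 ≤ A.card with hP
  calc _ ≤ ∑ z : ι → Fin p, ∑ A ∈ P with ∀ i ∈ A, y i = z i, 2 ^ A.card.choose 2 := by
        rw [Finset.sum_filter]
        refine Finset.sum_le_sum fun z _ => ?_
        split_ifs with h
        · exact Finset.single_le_sum (f := fun A : Finset ι => 2 ^ A.card.choose 2)
            (fun _ _ => Nat.zero_le _) (by simp [hP, h])
        · exact Nat.zero_le _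
    _ = ∑ A ∈ P, p ^ (s - A.card) * 2 ^ A.card.choose 2 := by
        simp only [Finset.sum_filter]
        rw [Finset.sum_comm]
        simp only [hP, Finset.sum_filter]
        refine Finset.sum_congr rfl fun A _ => ?_
        split_ifs with h
        · rw [← Finset.sum_filter, Finset.sum_const, card_agree_on, smul_eq_mul]
        · simp
    _ = ∑ j ∈ Finset.range (s + 1), ∑ A ∈ P with A.card = j,
          p ^ (s - A.card) * 2 ^ A.card.choose 2 := by
        refine (Finset.sum_fiberwise_of_maps_to (fun A _ => ?_) _).symm
        exact Finset.mem_range.2 (Nat.lt_succ_of_le (Finset.card_le_univ A))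
    -- Sizes `0` and `1` do not occur in `P`; keeping `1 ≤ j` leaves exactly `s` equal terms, hence
    -- the factor `s³`.
    _ ≤ ∑ j ∈ Finset.range (s + 1), if 1 ≤ j then 2 * s ^ 2 * p ^ (s - 2) else 0 := by
        refine Finset.sum_le_sum fun j hj => ?_
        by_cases hj2 : 2 ≤ j
        · rw [if_pos (by omega)]
          have : (P.filter fun A => A.card = j) = Finset.univ.powersetCard j := by
            ext A; simp only [hP, Finset.mem_filter, Finset.mem_univ, true_and,
              Finset.mem_powersetCard, Finset.subset_univ]
            constructor
            · exact fun h => h.2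
            · exact fun h => ⟨h ▸ hj2, h⟩
          rw [this, Finset.sum_congr rfl (g := fun _ => p ^ (s - j) * 2 ^ j.choose 2)
            (fun A hA => by rw [(Finset.mem_powersetCard.1 hA).2]), Finset.sum_const,
            Finset.card_powersetCard, Finset.card_univ, smul_eq_mul, ← hs]
          calc s.choose j * (p ^ (s - j) * 2 ^ j.choose 2)
              ≤ s ^ j * (p ^ (s - j) * 2 ^ j.choose 2) := by
                gcongr; exact Nat.choose_le_pow s j
            _ = s ^ j * 2 ^ j.choose 2 * p ^ (s - j) := by ring
            _ ≤ _ := pow_mul_two_pow_choose_le hp hj2 (by simpa [Nat.lt_succ_iff] using hj)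
        · rw [Finset.sum_eq_zero]
          · exact Nat.zero_le _
          · intro A hA
            simp only [hP, Finset.mem_filter] at hA
            omega
    _ = _ := by
        rw [Finset.sum_range_succ']; simp; ring

/-- Here the mean is `|F| 2 ^ (-C)` and `D = |F| 2 ^ (-2C) · 2 s³ p ^ (s - 2)`, so `mean² / (2D) =
|F| / (4 s³ p ^ (s - 2))`. Since `F` contains half of all `p ^ s` transversals, this is at least `p²
/ (8 s³)`. -/
theorem janson_transversal [Fintype V] {x : ι × Fin p → V} (hx : Function.Injective x)
    (hp : Fintype.card ι ^ 2 * 2 ^ (Fintype.card ι + 1) ≤ p ^ 2) (hι : 2 ≤ Fintype.card ι)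
    (F : Finset (ι → Fin p)) (hF : p ^ Fintype.card ι ≤ 2 * F.card) :
    bitProb (fun ω : Sym2 V → Bool => ∀ y ∈ F, ¬ (bitGraph ω).IsClique (transversal x y)) ≤
      Real.exp (-(p : ℝ) ^ 2 / (8 * (Fintype.card ι : ℝ) ^ 3)) := by
  set s := Fintype.card ι with hs
  set C := s.choose 2 with hC
  have hp0 : 0 < p := by
    rcases Nat.eq_zero_or_pos p with h | h
    · subst h; simp at hp; omega
    · exact h
  set D : ℝ := F.card * ((1 / 2) ^ (2 * C) * (2 * s ^ 3 * p ^ (s - 2))) with hD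
  have hFpos : 0 < F.card := by
    have : 0 < p ^ s := by positivity
    omega
  have hs0 : (0 : ℝ) < s := by exact_mod_cast (by omega : 0 < s)
  have hpR : (0 : ℝ) < p := by exact_mod_cast hp0
  have hDpos : 0 < D := by rw [hD]; positivity
  have hcard : ∀ y z : ι → Fin p, (1 / 2 : ℝ) ^ (pairs (transversal x y) ∪
      pairs (transversal x z)).card = (1 / 2) ^ (2 * C) *
      2 ^ (Finset.univ.filter fun i => y i = z i).card.choose 2 := by
    intro y z
    have h := Finset.card_union_add_card_inter (pairs (transversal x y)) (pairs (transversal x z))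
    rw [pairs_inter, card_pairs, card_pairs, card_pairs, card_transversal hx, card_transversal hx,
      card_transversal_inter hx, ← hs, ← hC, ← two_mul] at h
    rw [← h, pow_add, mul_assoc, ← mul_pow]
    norm_num
  have h := janson F (fun y => pairs (transversal x y)) D ?_ hDpos
  · simp only [forall_pairs_iff_isClique] at h
    refine h.trans (Real.exp_le_exp.2 ?_)
    have hm : ∑ y ∈ F, (1 / 2 : ℝ) ^ (pairs (transversal x y)).card =
        F.card * (1 / 2) ^ C := by
      simp only [card_pairs, card_transversal hx]
      rw [Finset.sum_const, nsmul_eq_mul]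
    rw [hm, neg_div, neg_div, neg_le_neg_iff, hD]
    have hF' : (p : ℝ) ^ s ≤ 2 * F.card := by exact_mod_cast hF
    have hps : (p : ℝ) ^ s = p ^ 2 * p ^ (s - 2) := by rw [← pow_add]; congr 1; omega
    rw [div_le_div_iff₀ (by positivity) (by positivity)]
    have e1 : ((1 / 2 : ℝ) ^ C) ^ 2 = (1 / 2) ^ (2 * C) := by rw [← pow_mul, mul_comm]
    rw [mul_pow, e1]
    have hFR : (0 : ℝ) < F.card := by exact_mod_cast hFpos
    calc (p : ℝ) ^ 2 * (2 * ((F.card : ℝ) * ((1 / 2) ^ (2 * C) * (2 * s ^ 3 * p ^ (s - 2)))))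
        = (p ^ 2 * p ^ (s - 2)) * (4 * (F.card : ℝ) * (1 / 2) ^ (2 * C) * s ^ 3) := by ring
      _ ≤ (2 * (F.card : ℝ)) * (4 * (F.card : ℝ) * (1 / 2) ^ (2 * C) * s ^ 3) := by
        rw [← hps]; gcongr
      _ = _ := by ring
  · simp only [hcard, ← Finset.mul_sum, pairs_not_disjoint, card_transversal_inter hx]
    rw [hD, mul_left_comm, ← nsmul_eq_mul, ← Finset.sum_const]
    gcongr with y _
    refine le_trans (Finset.sum_le_sum_of_subset_of_nonneg
      (Finset.filter_subset_filter _ (Finset.subset_univ F)) fun _ _ _ => by positivity) ?_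
    exact_mod_cast sum_two_pow_agree_le y hp

open Classical in
/-- If the expected number of outside vertices dominating a random transversal is at most `1/2`,
then an undominated transversal forms a clique, except with tiny probability. -/
theorem bitProb_no_undominated_clique_le [Fintype V] {x : ι × Fin p → V}
    (hx : Function.Injective x)
    (hp : Fintype.card ι ^ 2 * 2 ^ (Fintype.card ι + 1) ≤ p ^ 2) (hι : 2 ≤ Fintype.card ι) :
    bitProb (fun ω : Sym2 V → Bool =>
      2 * ∑ v with v ∉ Set.range x, ∏ i, (Finset.univ.filter fun a =>
        (bitGraph ω).Adj v (x (i, a))).card ≤ p ^ Fintype.card ι ∧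
      ¬ ∃ y : ι → Fin p, (bitGraph ω).IsClique (transversal x y) ∧
        ∀ v, v ∉ Set.range x → ∃ i, ¬ (bitGraph ω).Adj v (x (i, y i))) ≤
      Real.exp (-(p : ℝ) ^ 2 / (8 * (Fintype.card ι : ℝ) ^ 3)) := by
  -- The coins on pairs inside the parts decide which transversals are cliques, the remaining ones
  -- decide domination. Only the coins in `I` are resampled, so the set `F` of undominated
  -- transversals is fixed when Janson is applied.
  set I : Finset (Sym2 V) := Finset.univ.filter fun e => ∀ u ∈ e, u ∈ Set.range x with hI
  have hout : ∀ (ω ω' : Sym2 V → Bool) v, v ∉ Set.range x → ∀ u,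
      (bitGraph (I.piecewise ω ω')).Adj v u ↔ (bitGraph ω').Adj v u := by
    intro ω ω' v hv u
    have : s(v, u) ∉ I := fun h => hv ((Finset.mem_filter.1 h).2 v (Sym2.mem_mk_left v u))
    simp [bitGraph, this]
  have hin : ∀ (ω ω' : Sym2 V → Bool) (y : ι → Fin p),
      (bitGraph (I.piecewise ω ω')).IsClique (transversal x y) ↔
      (bitGraph ω).IsClique (transversal x y) := by
    intro ω ω' y
    rw [← forall_pairs_iff_isClique, ← forall_pairs_iff_isClique]
    refine forall₂_congr fun e he => ?_
    have : e ∈ I := by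
      induction e with | _ u v
      obtain ⟨hu, hv, -⟩ := mem_pairs.1 he
      simp only [transversal, Finset.mem_image, Finset.mem_univ, true_and] at hu hv
      obtain ⟨i, rfl⟩ := hu
      obtain ⟨j, rfl⟩ := hv
      simp [hI]
    simp [this]
  rw [bitProb, bitAvg_piecewise I]
  refine (bitAvg_mono fun ω' => ?_).trans (bitAvg_const _).le
  by_cases hcond : 2 * ∑ v with v ∉ Set.range x, ∏ i, (Finset.univ.filter fun a =>
        (bitGraph ω').Adj v (x (i, a))).card ≤ p ^ Fintype.card ι
  · set F : Finset (ι → Fin p) := Finset.univ.filter fun y =>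
      ∀ v, v ∉ Set.range x → ∃ i, ¬ (bitGraph ω').Adj v (x (i, y i)) with hF
    have hFc : p ^ Fintype.card ι ≤ 2 * F.card := by
      -- A transversal dominated by `v` picks a neighbour of `v` in each part, so the sum in the
      -- hypothesis bounds the number of dominated transversals.
      have h1 : Fᶜ ⊆ (Finset.univ.filter fun v => v ∉ Set.range x).biUnion fun v =>
          Fintype.piFinset fun i => Finset.univ.filter fun a =>
            (bitGraph ω').Adj v (x (i, a)) := by
        intro y hy
        simp only [hF, Finset.mem_compl, Finset.mem_filter, Finset.mem_univ, true_and, not_forall,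
          not_exists, not_not] at hy
        obtain ⟨v, hv, h⟩ := hy
        simp only [Finset.mem_biUnion, Finset.mem_filter, Finset.mem_univ, true_and,
          Fintype.mem_piFinset]
        exact ⟨v, hv, h⟩
      have h2 := (Finset.card_le_card h1).trans Finset.card_biUnion_le
      simp only [Fintype.card_piFinset] at h2
      have h3 := Finset.card_add_card_compl F
      simp only [Fintype.card_fun, Fintype.card_fin] at h3
      omega
    refine le_trans ?_ (janson_transversal hx hp hι F hFc)
    refine bitAvg_mono fun ω => ?_
    split_ifs with h1 h2 h2
    · rfl
    · refine absurd (fun y hy hc => h1.2 ⟨y, (hin _ _ _).2 hc, fun v hv => ?_⟩) h2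
      obtain ⟨i, hi⟩ := (Finset.mem_filter.1 hy).2 v hv
      exact ⟨i, fun h => hi ((hout _ _ _ hv _).1 h)⟩
    · norm_num
    · rfl
  · refine le_trans (bitAvg_mono (g := fun _ => 0) fun ω => ?_) ?_
    · rw [if_neg]
      rintro ⟨h, -⟩
      apply hcond
      refine le_trans (le_of_eq ?_) h
      congr 1
      refine Finset.sum_congr rfl fun v hv => Finset.prod_congr rfl fun i _ => ?_
      congr 1
      ext a
      simp [hout ω ω' v (Finset.mem_filter.1 hv).2]
    · rw [bitAvg_const]; exact (Real.exp_pos _).le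

end Transversal

/-! ### Pseudorandom properties by exponential moments and union bounds -/

theorem injOn_sym2_mk_of_disjoint {V : Type*} {P W : Finset V} (h : Disjoint W P) :
    Set.InjOn (fun z : V × V => s(z.1, z.2)) (W ×ˢ P : Finset (V × V)) := by
  rintro ⟨a, b⟩ hab ⟨c, d⟩ hcd he
  simp only [Finset.coe_product, Set.mem_prod, Finset.mem_coe] at hab hcd
  simp only [Sym2.eq_iff] at he
  rcases he with ⟨rfl, rfl⟩ | ⟨rfl, rfl⟩
  · rfl
  · exact absurd hcd.2 (Finset.disjoint_left.1 h hab.1)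

section Stars
variable {V : Type*} [Fintype V] [DecidableEq V]

theorem bitAvg_prod_star {P W : Finset V} (hPW : Disjoint W P) (h : Bool → ℝ) :
    bitAvg (fun ω : Sym2 V → Bool => ∏ w ∈ W, ∏ u ∈ P, h (ω s(w, u))) =
      (((h true + h false) / 2) ^ P.card) ^ W.card := by
  have := bitAvg_prod_coord (W ×ˢ P) (fun z : V × V => s(z.1, z.2))
    (injOn_sym2_mk_of_disjoint hPW) h
  simp only [Finset.prod_product, Finset.card_product] at this
  rw [this, ← pow_mul, mul_comm]

open Classical in
/-- Union bound for the event that some set `Q` has `m` outside vertices with property `A`, when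
`A` is controlled by an exponential moment of the edges to `Q`. -/
theorem bitProb_exists_star_le (q m : ℕ) (A : Finset V → (Sym2 V → Bool) → V → Prop)
    (h : Bool → ℝ) (h0 : ∀ b, 0 ≤ h b) (c : ℝ) (hc : 0 ≤ c)
    (hA : ∀ Q : Finset V, Q.card = q → ∀ ω, ∀ v ∉ Q, A Q ω v → 1 ≤ c * ∏ u ∈ Q, h (ω s(v, u))) :
    bitProb (fun ω : Sym2 V → Bool => ∃ Q : Finset V, Q.card = q ∧
      m ≤ (Finset.univ.filter fun v => v ∉ Q ∧ A Q ω v).card) ≤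
      (Fintype.card V).choose q * (Fintype.card V).choose m *
        (c * ((h true + h false) / 2) ^ q) ^ m := by
  set I := (Finset.univ : Finset V).powersetCard q ×ˢ (Finset.univ : Finset V).powersetCard m
  have hI : ∀ z ∈ I, z.1.card = q ∧ z.2.card = m := fun z hz =>
    ⟨(Finset.mem_powersetCard.1 (Finset.mem_product.1 hz).1).2,
      (Finset.mem_powersetCard.1 (Finset.mem_product.1 hz).2).2⟩
  calc _ ≤ bitProb (fun ω => ∃ z ∈ I, ∀ w ∈ z.2, w ∉ z.1 ∧ A z.1 ω w) := by
        refine bitProb_mono fun ω hω => ?_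
        obtain ⟨Q, hQ, hm⟩ := hω
        obtain ⟨W, hW, hWc⟩ := Finset.exists_subset_card_eq hm
        refine ⟨(Q, W), Finset.mem_product.2 ⟨Finset.mem_powersetCard.2 ⟨Finset.subset_univ _, hQ⟩,
          Finset.mem_powersetCard.2 ⟨Finset.subset_univ _, hWc⟩⟩, fun w hw => ?_⟩
        exact (Finset.mem_filter.1 (hW hw)).2
    _ ≤ ∑ z ∈ I, bitProb (fun ω => ∀ w ∈ z.2, w ∉ z.1 ∧ A z.1 ω w) := bitProb_exists_le _ _
    -- For disjoint `Q` and `W` the pairs between them are distinct coins, so the `m` exponential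
    -- moments are independent. If they meet, the event is impossible.
    _ ≤ ∑ z ∈ I, (c * ((h true + h false) / 2) ^ q) ^ m := by
        refine Finset.sum_le_sum fun z hz => ?_
        have hnn : (0 : ℝ) ≤ (h true + h false) / 2 := by linarith [h0 true, h0 false]
        by_cases hd : Disjoint z.2 z.1
        · have h1 := bitAvg_prod_star hd h
          rw [(hI z hz).1, (hI z hz).2] at h1
          rw [mul_pow, ← h1, ← bitAvg_const_mul]
          refine bitProb_le_bitAvg (fun ω => mul_nonneg (pow_nonneg hc _)
            (Finset.prod_nonneg fun _ _ => Finset.prod_nonneg fun _ _ => h0 _)) fun ω hω => ?_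
          rw [← (hI z hz).2, ← Finset.prod_const, ← Finset.prod_mul_distrib]
          have := Finset.prod_le_prod (s := z.2) (f := fun _ => (1 : ℝ))
            (g := fun w => c * ∏ u ∈ z.1, h (ω s(w, u))) (fun _ _ => zero_le_one)
            (fun w hw => hA z.1 (hI z hz).1 ω w (hω w hw).1 (hω w hw).2)
          simpa using this
        · rw [Finset.not_disjoint_iff] at hd
          obtain ⟨w, hw, hw'⟩ := hd
          refine (bitProb_le_bitAvg (f := fun _ => 0) (fun _ => le_rfl) fun ω hω => ?_).trans ?_
          · exact absurd hw' (hω w hw).1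
          · rw [bitAvg_const]; positivity
    _ = _ := by
        rw [Finset.sum_const, nsmul_eq_mul, Finset.card_product, Finset.card_powersetCard,
          Finset.card_powersetCard, Finset.card_univ]
        push_cast; ring

/-- The Chernoff moment of one coin with parameter `4b`, which optimizes `cosh x ≤ exp (x² / 2)`. -/
theorem exp_moment_half (b : ℝ) :
    (Real.exp (4 * b * (1 / 2 - b)) + Real.exp (4 * b * (-(1 / 2) - b))) / 2 ≤
      Real.exp (-(2 * b ^ 2)) := by
  have h := Real.cosh_le_exp_half_sq (2 * b)
  rw [Real.cosh_eq] at h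
  have e1 : Real.exp (4 * b * (1 / 2 - b)) = Real.exp (-(4 * b ^ 2)) * Real.exp (2 * b) := by
    rw [← Real.exp_add]; ring_nf
  have e2 : Real.exp (4 * b * (-(1 / 2) - b)) = Real.exp (-(4 * b ^ 2)) * Real.exp (-(2 * b)) := by
    rw [← Real.exp_add]; ring_nf
  have e3 : Real.exp (-(2 * b ^ 2)) = Real.exp (-(4 * b ^ 2)) * Real.exp ((2 * b) ^ 2 / 2) := by
    rw [← Real.exp_add]; ring_nf
  rw [e1, e2, e3, ← mul_add, mul_div_assoc]
  gcongr

open Classical in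
/-- Few vertices have noticeably more than half of a set of size `p` as neighbours. -/
theorem bitProb_many_large_degree_le (p T : ℕ) (b : ℝ) (hb : 0 ≤ b) :
    bitProb (fun ω : Sym2 V → Bool => ∃ P : Finset V, P.card = p ∧
      T ≤ (Finset.univ.filter fun v => v ∉ P ∧
        (1 / 2 + b) * p < (P.filter fun u => (bitGraph ω).Adj v u).card).card) ≤
      (Fintype.card V).choose p * (Fintype.card V).choose T *
        Real.exp (-(2 * b ^ 2 * p * T)) := by
  refine (bitProb_exists_star_le p T _ (fun a => if a then Real.exp (4 * b * (1 / 2 - b))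
    else Real.exp (4 * b * (-(1 / 2) - b))) ?_ 1 zero_le_one ?_).trans ?_
  · intro a; split_ifs <;> exact (Real.exp_pos _).le
  · intro P hP ω v hv hd
    have hadj : ∀ u ∈ P, (bitGraph ω).Adj v u ↔ ω s(v, u) = true := fun u hu =>
      ⟨fun h => h.2, fun h => ⟨fun e => hv (e ▸ hu), h⟩⟩
    rw [Finset.filter_congr hadj] at hd
    set d := (P.filter fun u => ω s(v, u) = true).card with hdd
    have hsum : (P.filter fun u => ¬ ω s(v, u) = true).card = (p : ℝ) - d := by
      rw [eq_sub_iff_add_eq', ← hP]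
      exact_mod_cast Finset.card_filter_add_card_filter_not (s := P) fun u => ω s(v, u) = true
    rw [one_mul, Finset.prod_ite, Finset.prod_const, Finset.prod_const, ← Real.exp_nat_mul,
      ← Real.exp_nat_mul, ← Real.exp_add, hsum, ← hdd]
    apply Real.one_le_exp
    have : (d : ℝ) * (4 * b * (1 / 2 - b)) + (p - d) * (4 * b * (-(1 / 2) - b)) =
        4 * b * (d - (1 / 2 + b) * p) := by ring
    rw [this]
    have := sub_pos.2 hd
    positivity
  · simp only [if_true, Bool.false_eq_true, if_false, one_mul]
    have h := exp_moment_half b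
    have e : Real.exp (-(2 * b ^ 2 * p * T)) = (Real.exp (-(2 * b ^ 2)) ^ p) ^ T := by
      rw [← pow_mul, ← Real.exp_nat_mul]; push_cast; ring_nf
    rw [e]
    gcongr

open Classical in
/-- Few vertices are adjacent to almost all of a set of size `q`. -/
theorem bitProb_many_almost_dominating_le (q m : ℕ) :
    bitProb (fun ω : Sym2 V → Bool => ∃ Q : Finset V, Q.card = q ∧
      m ≤ (Finset.univ.filter fun v => v ∉ Q ∧
        40 * (Q.filter fun u => ¬ (bitGraph ω).Adj v u).card ≤ q).card) ≤
      (Fintype.card V).choose q * (Fintype.card V).choose m *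
        (2 : ℝ) ^ (-(4 / 5 * q * m : ℝ)) := by
  -- Non-neighbours get weight `1/16 = 2 ^ (-4)`, so at most `q / 40` of them cost at most `2 ^ (-q
  -- / 10)`, which `c` compensates. The mean weight `17/32` is below `2 ^ (-9/10)`, leaving `2 ^
  -- (-4q / 5)` for each vertex. Any exponent above `3/4` would suffice later.
  refine (bitProb_mono fun ω ⟨Q, hQ, h⟩ => ⟨Q, hQ, h.trans (Finset.card_le_card fun v hv => by
    simpa only [Finset.mem_filter] using hv)⟩).trans
    ((bitProb_exists_star_le q m (fun Q ω v =>
      40 * (Q.filter fun u => ¬ (bitGraph ω).Adj v u).card ≤ q) (fun a => if a then 1 else 1 / 16) ?_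
    ((2 : ℝ) ^ (q / 10 : ℝ)) (by positivity) ?_).trans ?_)
  · intro a; split_ifs <;> norm_num
  · intro P hP ω v hv hd
    have hadj : ∀ u ∈ P, ¬ (bitGraph ω).Adj v u ↔ ¬ ω s(v, u) = true := fun u hu =>
      not_congr ⟨fun h => h.2, fun h => ⟨fun e => hv (e ▸ hu), h⟩⟩
    rw [Finset.filter_congr hadj] at hd
    rw [Finset.prod_ite, Finset.prod_const, Finset.prod_const, one_pow, one_mul]
    set d := (P.filter fun u => ¬ ω s(v, u) = true).card with hdd
    have e : ((1 : ℝ) / 16) ^ d = (2 : ℝ) ^ (-(4 * d) : ℝ) := by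
      rw [show (1 : ℝ) / 16 = (2 : ℝ) ^ (-4 : ℝ) by
        rw [Real.rpow_neg (by norm_num)]; norm_num, ← Real.rpow_natCast, ← Real.rpow_mul
        (by norm_num)]
      ring_nf
    rw [e, ← Real.rpow_add (by norm_num)]
    apply Real.one_le_rpow (by norm_num)
    have : (40 * d : ℝ) ≤ q := by exact_mod_cast hd
    linarith
  · have key : (2 : ℝ) ^ (1 / 10 : ℝ) * (17 / 32) ≤ (2 : ℝ) ^ (-(4 / 5) : ℝ) := by
      have h1 : (17 / 32 : ℝ) ≤ (2 : ℝ) ^ (-(9 / 10) : ℝ) := by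
        refine le_of_pow_le_pow_left₀ (n := 10) (by norm_num) (by positivity) ?_
        rw [← Real.rpow_natCast (_ ^ _), ← Real.rpow_mul (by norm_num)]
        rw [show -(9 / 10 : ℝ) * ((10 : ℕ) : ℝ) = -(9 : ℕ) by norm_num,
          Real.rpow_neg (by norm_num), Real.rpow_natCast]
        norm_num
      calc _ ≤ (2 : ℝ) ^ (1 / 10 : ℝ) * (2 : ℝ) ^ (-(9 / 10) : ℝ) := by gcongr
        _ = _ := by rw [← Real.rpow_add (by norm_num)]; norm_num
    simp only [if_true, Bool.false_eq_true, if_false]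
    have e1 : (2 : ℝ) ^ (q / 10 : ℝ) = ((2 : ℝ) ^ (1 / 10 : ℝ)) ^ q := by
      rw [← Real.rpow_natCast (_ ^ _), ← Real.rpow_mul (by norm_num)]; ring_nf
    have e2 : (2 : ℝ) ^ (-(4 / 5 * q * m : ℝ)) = (((2 : ℝ) ^ (-(4 / 5) : ℝ)) ^ q) ^ m := by
      rw [← pow_mul, ← Real.rpow_natCast (_ ^ _), ← Real.rpow_mul (by norm_num)]
      push_cast; ring_nf
    rw [e1, e2, ← mul_pow, show ((1 : ℝ) + 1 / 16) / 2 = 17 / 32 by norm_num]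
    gcongr

open Classical in
/-- Every set of `k` vertices has many common non-neighbours. -/
theorem bitProb_few_common_nonneighbors_le (k N : ℕ) :
    bitProb (fun ω : Sym2 V → Bool => ∃ S : Finset V, S.card = k ∧
      (Finset.univ.filter fun w => w ∉ S ∧ ∀ v ∈ S, ¬ (bitGraph ω).Adj w v).card < N) ≤
      (Fintype.card V).choose k * (2 ^ N * (1 - (1 / 2) ^ k / 2) ^ (Fintype.card V - k)) := by
  calc _ ≤ bitProb (fun ω : Sym2 V → Bool => ∃ S ∈ (Finset.univ : Finset V).powersetCard k,
        (Finset.univ.filter fun w => w ∉ S ∧ ∀ v ∈ S, ¬ (bitGraph ω).Adj w v).card < N) := by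
        refine bitProb_mono fun ω ⟨S, hS, h⟩ => ⟨S, ?_, h⟩
        exact Finset.mem_powersetCard.2 ⟨Finset.subset_univ _, hS⟩
    _ ≤ ∑ S ∈ (Finset.univ : Finset V).powersetCard k, bitProb (fun ω : Sym2 V → Bool =>
        (Finset.univ.filter fun w => w ∉ S ∧ ∀ v ∈ S, ¬ (bitGraph ω).Adj w v).card < N) :=
        bitProb_exists_le _ _
    _ ≤ ∑ S ∈ (Finset.univ : Finset V).powersetCard k,
        (2 ^ N * (1 - (1 / 2) ^ k / 2) ^ (Fintype.card V - k)) := by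
        refine Finset.sum_le_sum fun S hS => ?_
        have hSc := (Finset.mem_powersetCard.1 hS).2
        -- Each common non-neighbour contributes a factor `1/2`, so `2 ^ N * ∏ g ≥ 1` whenever there
        -- are fewer than `N` of them; the factors for different `w` use disjoint coins.
        set g : V → (Sym2 V → Bool) → ℝ := fun w ω =>
          1 - 1 / 2 * ∏ v ∈ S, if ω s(w, v) = true then 0 else 1 with hg
        have hgv : ∀ w ω, g w ω = if ∀ v ∈ S, ¬ ω s(w, v) = true then 1 / 2 else 1 := by
          intro w ω
          have : ∏ v ∈ S, (if ω s(w, v) = true then (0 : ℝ) else 1) =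
              if ∀ v ∈ S, ¬ ω s(w, v) = true then 1 else 0 := by
            by_cases h : ∀ v ∈ S, ¬ ω s(w, v) = true
            · rw [if_pos h, Finset.prod_eq_one fun v hv => if_neg (h v hv)]
            · rw [if_neg h]
              push Not at h
              obtain ⟨v, hv, hv'⟩ := h
              exact Finset.prod_eq_zero hv (if_pos hv')
          rw [hg]; dsimp only; rw [this]
          split_ifs <;> norm_num
        have hdep : ∀ w, DependsOn (g w) {e | ∃ v ∈ S, e = s(w, v)} := by
          intro w x y hxy
          simp only [hg]
          congr 2
          exact Finset.prod_congr rfl fun v hv => by rw [hxy _ ⟨v, hv, rfl⟩]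
        have hdisj : ((Sᶜ : Finset V) : Set V).PairwiseDisjoint
            fun w => {e : Sym2 V | ∃ v ∈ S, e = s(w, v)} := by
          intro w hw w' hw' hne
          refine Set.disjoint_left.2 ?_
          rintro e ⟨v, hv, rfl⟩ ⟨v', hv', he⟩
          rcases Sym2.eq_iff.1 he with ⟨h, -⟩ | ⟨h, -⟩
          · exact hne h
          · exact (Finset.mem_compl.1 (Finset.mem_coe.1 hw)) (h ▸ hv')
        have havg : ∀ w ∈ Sᶜ, bitAvg (g w) = 1 - (1 / 2) ^ k / 2 := by
          intro w hw
          have h1 := bitAvg_prod_coord S (fun v => s(w, v)) (fun a _ b _ h =>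
            Sym2.congr_right.1 h) (fun b => if b = true then (0 : ℝ) else 1)
          have h2 := bitAvg_sub (fun _ : Sym2 V → Bool => (1 : ℝ))
            (fun ω => 1 / 2 * ∏ v ∈ S, if ω s(w, v) = true then (0 : ℝ) else 1)
          rw [bitAvg_const, bitAvg_const_mul, h1, hSc] at h2
          rw [hg]; dsimp only; rw [h2]; norm_num; ring
        have hprod := bitAvg_prod Sᶜ _ g (fun w _ => hdep w) hdisj
        rw [Finset.prod_congr rfl havg, Finset.prod_const, Finset.card_compl, hSc] at hprod
        rw [← hprod, ← bitAvg_const_mul]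
        have hg0 : ∀ w ω, 0 ≤ g w ω := fun w ω => by rw [hgv]; split_ifs <;> norm_num
        refine bitProb_le_bitAvg (fun ω => mul_nonneg (by positivity)
          (Finset.prod_nonneg fun w _ => hg0 w ω)) fun ω hω => ?_
        simp only [hgv]
        rw [Finset.prod_ite, Finset.prod_const, Finset.prod_const_one, mul_one]
        have hcard : (Sᶜ.filter fun w => ∀ v ∈ S, ¬ ω s(w, v) = true).card ≤ N := by
          refine (Finset.card_le_card fun w hw => ?_).trans hω.le
          obtain ⟨h1, h2⟩ := Finset.mem_filter.1 hw
          exact Finset.mem_filter.2 ⟨Finset.mem_univ _, Finset.mem_compl.1 h1,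
            fun v hv h => h2 v hv h.2⟩
        calc (1 : ℝ) = 2 ^ N * (1 / 2) ^ N := by rw [← mul_pow]; norm_num
          _ ≤ _ := by
            gcongr 2 ^ N * ?_
            exact pow_le_pow_of_le_one (by norm_num) (by norm_num) hcard
    _ = _ := by rw [Finset.sum_const, nsmul_eq_mul, Finset.card_powersetCard, Finset.card_univ]

end Stars

/-! ### The deterministic part of the lower bound -/

theorem prod_div_le_exp {r : ℕ} {p N : ℝ} (hp : 0 < p) {d : Fin r → ℝ} (hd : ∀ i, 0 ≤ d i)
    (hsum : ∑ i, d i + N = r * p) (hN : r * p < 40 * N) :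
    ∏ i, d i / p ≤ Real.exp (-(r / 40 : ℝ)) := by
  calc ∏ i, d i / p ≤ ∏ i, Real.exp (d i / p - 1) :=
        Finset.prod_le_prod (fun i _ => div_nonneg (hd i) hp.le) fun i _ => by
          linarith [Real.add_one_le_exp (d i / p - 1)]
    _ = Real.exp (∑ i, (d i / p - 1)) := (Real.exp_sum _ _).symm
    _ ≤ _ := by
        rw [Real.exp_le_exp, Finset.sum_sub_distrib, ← Finset.sum_div]
        have : (∑ i, d i) / p ≤ r - r / 40 := by
          rw [div_le_iff₀ hp]; linarith
        simp only [Finset.sum_const, Finset.card_univ, Fintype.card_fin, nsmul_eq_mul, mul_one]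
        linarith

section Deterministic
variable {V : Type*} [Fintype V] [DecidableEq V] {r t p : ℕ}

open Classical in
/-- A set in which every vertex has at least `(r + t) * p` non-neighbours contains `r + t` disjoint
parts of size `p`, such that each vertex dominating almost all of the first `r` parts misses one of
the last `t` parts entirely. -/
theorem exists_parts [Nonempty V] (G : SimpleGraph V)
    (h2 : ∀ Q : Finset V, Q.card = r * p → (Finset.univ.filter fun v => v ∉ Q ∧
      40 * (Q.filter fun u => ¬ G.Adj v u).card ≤ r * p).card ≤ t)
    (A : Finset V) (hA : ∀ v, (r + t) * p ≤ (A.filter fun u => ¬ G.Adj v u).card) :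
    ∃ x : (Fin r ⊕ Fin t) × Fin p → V, Function.Injective x ∧ (∀ z, x z ∈ A) ∧
      ∀ v, v ∉ Set.range x →
        r * p < 40 * (Finset.univ.filter fun z : Fin r × Fin p =>
          ¬ G.Adj v (x (Sum.inl z.1, z.2))).card ∨
        ∃ j, ∀ a, ¬ G.Adj v (x (Sum.inr j, a)) := by
  have hAc : r * p ≤ A.card := by
    have := (hA (Classical.arbitrary V)).trans (Finset.card_le_card (Finset.filter_subset _ _))
    nlinarith
  obtain ⟨Q, hQA, hQ⟩ := Finset.exists_subset_card_eq hAc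
  set B := Finset.univ.filter fun v => v ∉ Q ∧
      40 * (Q.filter fun u => ¬ G.Adj v u).card ≤ r * p with hB
  have hBt : B.card ≤ t := h2 Q hQ
  -- The almost dominating vertices are listed with padding, so that the number of extra parts is
  -- exactly `t`.
  obtain ⟨b, hb⟩ : ∃ b : Fin t → V, ∀ v ∈ B, ∃ j, b j = v := by
    refine ⟨fun j => if h : (j : ℕ) < B.card then (B.equivFin.symm ⟨j, h⟩ : V) else
      Classical.arbitrary V, fun v hv => ?_⟩
    have hlt := (B.equivFin ⟨v, hv⟩).2
    exact ⟨⟨B.equivFin ⟨v, hv⟩, hlt.trans_le hBt⟩, by simp⟩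
  set D : Fin t → Finset V := fun j => (A.filter fun u => ¬ G.Adj (b j) u) \ Q with hD
  have hDc : ∀ j, t * p ≤ (D j).card := by
    intro j
    have h1 := Finset.le_card_sdiff Q (A.filter fun u => ¬ G.Adj (b j) u)
    have h3 := hA (b j)
    rw [add_mul] at h3
    rw [hD]; dsimp only; omega
  -- Hall's condition is immediate: there are only `t * p` places to fill, and each has at least `t
  -- * p` candidates outside `Q`.
  obtain ⟨f, hf, hfD⟩ := (Finset.all_card_le_biUnion_card_iff_exists_injective
    (fun z : Fin t × Fin p => D z.1)).1 (fun s => by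
      rcases s.eq_empty_or_nonempty with rfl | ⟨z, hz⟩
      · simp
      · calc s.card ≤ t * p := by simpa using s.card_le_univ
          _ ≤ (D z.1).card := hDc _
          _ ≤ _ := Finset.card_le_card (Finset.subset_biUnion_of_mem
            (fun z : Fin t × Fin p => D z.1) hz))
  have e : Fin r × Fin p ≃ Q := Fintype.equivOfCardEq (by simp [hQ])
  set x : (Fin r ⊕ Fin t) × Fin p → V := fun z => Sum.elim (fun i => (e (i, z.2) : V))
    (fun j => f (j, z.2)) z.1 with hx
  have hfQ : ∀ z, f z ∉ Q := fun z => (Finset.mem_sdiff.1 (hfD z)).2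
  refine ⟨x, ?_, ?_, ?_⟩
  · rintro ⟨i | i, a⟩ ⟨j | j, c⟩ h
    · have := e.injective (Subtype.ext (show (e (i, a) : V) = e (j, c) from h))
      simp only [Prod.mk.injEq] at this
      rw [this.1, this.2]
    · have h' : (e (i, a) : V) = f (j, c) := h
      exact absurd (h' ▸ (e (i, a)).2) (hfQ _)
    · have h' : f (i, a) = (e (j, c) : V) := h
      exact absurd (h' ▸ (e (j, c)).2) (hfQ _)
    · have := hf (show f (i, a) = f (j, c) from h)
      simp only [Prod.mk.injEq] at this
      rw [this.1, this.2]
  · rintro ⟨i | i, a⟩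
    · exact hQA (e (i, a)).2
    · exact (Finset.mem_filter.1 (Finset.mem_sdiff.1 (hfD (i, a))).1).1
  · intro v hv
    have hvQ : v ∉ Q := fun h => hv ⟨(Sum.inl (e.symm ⟨v, h⟩).1, (e.symm ⟨v, h⟩).2), by simp [hx]⟩
    by_cases hvB : v ∈ B
    · right
      obtain ⟨j, rfl⟩ := hb v hvB
      exact ⟨j, fun a => (Finset.mem_filter.1 (Finset.mem_sdiff.1 (hfD (j, a))).1).2⟩
    · left
      have : r * p < 40 * (Q.filter fun u => ¬ G.Adj v u).card := by
        simp only [hB, Finset.mem_filter, Finset.mem_univ, true_and, not_and, not_le] at hvB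
        exact hvB hvQ
      refine this.trans_le (Nat.mul_le_mul_left _ ?_)
      refine Finset.card_le_card_of_surjOn (fun z => (e z : V)) fun u hu => ?_
      obtain ⟨hu1, hu2⟩ := Finset.mem_filter.1 (Finset.mem_coe.1 hu)
      exact ⟨e.symm ⟨u, hu1⟩, by simpa [hx] using hu2, by simp⟩

open Classical in
-- Divided by `p ^ (r + t)`, the sum is the expected number of outside vertices dominating a random
-- transversal. A vertex of degree at most `(1/2 + b) p` into every part contributes at most `(1/2 +
-- b) ^ (r + t)`. There are at most `(r + t) * T` other vertices; each contributes `0` if it misses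
-- a part entirely, and otherwise at most `exp (-r / 40)`, because it misses more than a fraction
-- `1/40` of the first `r` parts.
theorem two_mul_sum_prod_degree_le (G : SimpleGraph V) (b : ℝ) (T : ℕ)
    (hb : 0 ≤ b) (hp : 0 < p)
    (h3 : ∀ P : Finset V, P.card = p → (Finset.univ.filter fun v => v ∉ P ∧
      (1 / 2 + b) * p < (P.filter fun u => G.Adj v u).card).card ≤ T)
    (h5 : Fintype.card V * (1 / 2 + b) ^ (r + t) + (r + t) * T * Real.exp (-(r / 40 : ℝ)) ≤ 1 / 2)
    (x : (Fin r ⊕ Fin t) × Fin p → V) (hx : Function.Injective x)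
    (hdom : ∀ v, v ∉ Set.range x →
        r * p < 40 * (Finset.univ.filter fun z : Fin r × Fin p =>
          ¬ G.Adj v (x (Sum.inl z.1, z.2))).card ∨
        ∃ j, ∀ a, ¬ G.Adj v (x (Sum.inr j, a))) :
    2 * ∑ v with v ∉ Set.range x, ∏ i, (Finset.univ.filter fun a =>
        G.Adj v (x (i, a))).card ≤ p ^ Fintype.card (Fin r ⊕ Fin t) := by
  set d : V → Fin r ⊕ Fin t → ℕ := fun v i => (Finset.univ.filter fun a =>
        G.Adj v (x (i, a))).card with hd
  have hdp : ∀ v i, d v i ≤ p := fun v i => by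
    simpa using Finset.card_le_univ (Finset.univ.filter fun a => G.Adj v (x (i, a)))
  have hpR : (0 : ℝ) < p := by exact_mod_cast hp
  set Sp : Finset V := Finset.univ.filter fun v => v ∉ Set.range x ∧ ∃ i, (1 / 2 + b) * p < d v i
    with hSp
  have hSpc : Sp.card ≤ (r + t) * T := by
    have hsub : Sp ⊆ (Finset.univ : Finset (Fin r ⊕ Fin t)).biUnion fun i =>
        Finset.univ.filter fun v => v ∉ Finset.univ.image (fun a => x (i, a)) ∧
        (1 / 2 + b) * p < ((Finset.univ.image fun a => x (i, a)).filter fun u => G.Adj v u).card := by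
      intro v hv
      obtain ⟨hv1, i, hv2⟩ := (Finset.mem_filter.1 hv).2
      refine Finset.mem_biUnion.2 ⟨i, Finset.mem_univ _, Finset.mem_filter.2 ⟨Finset.mem_univ _,
        fun h => ?_, ?_⟩⟩
      · obtain ⟨a, -, ha⟩ := Finset.mem_image.1 h
        exact hv1 ⟨_, ha⟩
      · rw [Finset.filter_image, Finset.card_image_of_injective]
        · exact hv2
        · intro a c h
          exact (Prod.ext_iff.1 (hx h)).2
    refine (Finset.card_le_card hsub).trans (Finset.card_biUnion_le.trans ?_)
    refine (Finset.sum_le_sum (g := fun _ => T) fun i _ => h3 _ ?_).trans ?_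
    · rw [Finset.card_image_of_injective]
      · simp
      · intro a c h
        exact (Prod.ext_iff.1 (hx h)).2
    · simp
  have hterm : ∀ v, v ∉ Set.range x → ∏ i, (d v i : ℝ) / p ≤
      (1 / 2 + b) ^ (r + t) + if v ∈ Sp then Real.exp (-(r / 40 : ℝ)) else 0 := by
    intro v hv
    have hd0 : ∀ i, 0 ≤ (d v i : ℝ) / p := fun i => by positivity
    have hd1 : ∀ i, (d v i : ℝ) / p ≤ 1 := fun i => by
      rw [div_le_one hpR]; exact_mod_cast hdp v i
    by_cases hvS : v ∈ Sp
    · rw [if_pos hvS]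
      refine le_trans ?_ (le_add_of_nonneg_left (by positivity))
      rcases hdom v hv with h | ⟨j, hj⟩
      · rw [Fintype.prod_sum_type]
        have h1 : ∏ j : Fin t, (d v (Sum.inr j) : ℝ) / p ≤ 1 :=
          Finset.prod_le_one (fun i _ => hd0 _) fun i _ => hd1 _
        have h3 : (∑ i : Fin r, (d v (Sum.inl i) : ℝ)) + (Finset.univ.filter
            fun z : Fin r × Fin p => ¬ G.Adj v (x (Sum.inl z.1, z.2))).card = r * p := by
          have e1 : ∑ i : Fin r, d v (Sum.inl i) = (Finset.univ.filter
            fun z : Fin r × Fin p => G.Adj v (x (Sum.inl z.1, z.2))).card := by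
            rw [Finset.card_filter, Fintype.sum_prod_type]
            exact Finset.sum_congr rfl fun i _ => Finset.card_filter _ _
          have e2 := Finset.card_filter_add_card_filter_not
            (s := (Finset.univ : Finset (Fin r × Fin p)))
            fun z => G.Adj v (x (Sum.inl z.1, z.2))
          rw [← e1] at e2
          simp only [Finset.card_univ, Fintype.card_prod, Fintype.card_fin] at e2
          exact_mod_cast e2
        have h2 : ∏ i : Fin r, (d v (Sum.inl i) : ℝ) / p ≤ Real.exp (-(r / 40 : ℝ)) :=
          prod_div_le_exp hpR (fun i => Nat.cast_nonneg _) h3 (by exact_mod_cast h)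
        exact (mul_le_of_le_one_right (Finset.prod_nonneg fun i _ => hd0 _) h1).trans h2
      · rw [Finset.prod_eq_zero (Finset.mem_univ (Sum.inr j))]
        · exact (Real.exp_pos _).le
        · have : d v (Sum.inr j) = 0 := by simp [hd, hj]
          simp [this]
    · rw [if_neg hvS, add_zero]
      have : ∀ i, (d v i : ℝ) / p ≤ 1 / 2 + b := by
        intro i
        rw [div_le_iff₀ hpR]
        by_contra h
        exact hvS (Finset.mem_filter.2 ⟨Finset.mem_univ _, hv, i, not_le.1 h⟩)
      calc _ ≤ ∏ i : Fin r ⊕ Fin t, (1 / 2 + b) :=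
            Finset.prod_le_prod (fun i _ => hd0 _) fun i _ => this i
        _ = _ := by simp
  have hsum : ∑ v with v ∉ Set.range x, ∏ i, (d v i : ℝ) / p ≤ 1 / 2 := by
    refine (Finset.sum_le_sum fun v hv => hterm v (Finset.mem_filter.1 hv).2).trans ?_
    rw [Finset.sum_add_distrib, Finset.sum_const, nsmul_eq_mul]
    refine le_trans (add_le_add ?_ ?_) h5
    · gcongr; exact Finset.card_le_univ _
    · rw [← Finset.sum_filter, Finset.sum_const, nsmul_eq_mul]
      gcongr
      have := (Finset.card_le_card (Finset.filter_subset_filter (fun v => v ∈ Sp)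
        (Finset.subset_univ (Finset.univ.filter fun v => v ∉ Set.range x)))).trans
          (by simpa using hSpc)
      exact_mod_cast this
  simp only [Finset.prod_div_distrib, Finset.prod_const, ← Finset.sum_div] at hsum
  rw [div_le_iff₀ (by positivity), Finset.card_univ] at hsum
  have : (2 : ℝ) * ∑ v with v ∉ Set.range x, ∏ i, (d v i : ℝ) ≤
      p ^ Fintype.card (Fin r ⊕ Fin t) := by linarith
  exact_mod_cast this

/-- Take a maximal clique among those inside the parts containing the transversal. No outside vertex
can extend it, as it would dominate the transversal, so it is maximal in `G`; and all parts have one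
colour. -/
theorem not_isCliqueColoring_of_undominated {κ ι : Type*} [Fintype ι] {G : SimpleGraph V}
    {c : V → κ} {i : κ} {x : ι × Fin p → V} (hx : Function.Injective x)
    (hι : 2 ≤ Fintype.card ι) (hc : ∀ z, c (x z) = i) {y : ι → Fin p}
    (hy : G.IsClique (transversal x y))
    (hdom : ∀ v, v ∉ Set.range x → ∃ i, ¬ G.Adj v (x (i, y i))) : ¬ G.IsCliqueColoring c := by
  classical
  intro hcol
  obtain ⟨M, hM, hmax⟩ := (Set.toFinite {S : Set V | G.IsClique S ∧ S ⊆ Set.range x}).exists_le_maximal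
    (a := (transversal x y : Set V)) ⟨hy, fun v hv => by
      obtain ⟨j, -, rfl⟩ := Finset.mem_image.1 (Finset.mem_coe.1 hv)
      exact ⟨_, rfl⟩⟩
  have hMc := hmax.prop
  refine hcol M ⟨hMc.1, fun S hS hMS => ?_⟩ ?_ ⟨i, fun v hv => ?_⟩
  · refine hmax.le_of_ge ⟨hS, fun v hv => ?_⟩ hMS
    by_contra hvx
    obtain ⟨j, hj⟩ := hdom v hvx
    have hmem : x (j, y j) ∈ S := hMS (hM (by simp [transversal]))
    exact hj (hS hv hmem fun h => hvx ⟨_, h.symm⟩)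
  · have : 1 < (transversal x y).card := by rw [card_transversal hx]; omega
    exact (Finset.one_lt_card_iff_nontrivial.1 this).mono hM
  · obtain ⟨z, rfl⟩ := hMc.2 hv
    exact hc z

open Classical in
-- One vertex per colour with the fewest non-neighbours in that colour replaces a union bound over
-- colour classes. Pigeonhole on the common non-neighbours of these vertices yields a class in which
-- even its minimizer has `(r + t) * p` non-neighbours.
theorem not_isCliqueColoring_of_pseudorandom (G : SimpleGraph V) (b : ℝ) (T K : ℕ)
    (hb : 0 ≤ b) (hp : 0 < p) (hrt : 2 ≤ r + t) (hK : 0 < K) (hKV : K ≤ Fintype.card V)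
    (h1 : ∀ S : Finset V, S.card = K → K * ((r + t) * p) ≤
      (Finset.univ.filter fun w => w ∉ S ∧ ∀ v ∈ S, ¬ G.Adj w v).card)
    (h2 : ∀ Q : Finset V, Q.card = r * p → (Finset.univ.filter fun v => v ∉ Q ∧
      40 * (Q.filter fun u => ¬ G.Adj v u).card ≤ r * p).card ≤ t)
    (h3 : ∀ P : Finset V, P.card = p → (Finset.univ.filter fun v => v ∉ P ∧
      (1 / 2 + b) * p < (P.filter fun u => G.Adj v u).card).card ≤ T)
    (h4 : ∀ x : (Fin r ⊕ Fin t) × Fin p → V, Function.Injective x →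
      2 * ∑ v with v ∉ Set.range x, ∏ i, (Finset.univ.filter fun a =>
        G.Adj v (x (i, a))).card ≤ p ^ Fintype.card (Fin r ⊕ Fin t) →
      ∃ y : Fin r ⊕ Fin t → Fin p, G.IsClique (transversal x y) ∧
        ∀ v, v ∉ Set.range x → ∃ i, ¬ G.Adj v (x (i, y i)))
    (h5 : Fintype.card V * (1 / 2 + b) ^ (r + t) + (r + t) * T * Real.exp (-(r / 40 : ℝ)) ≤ 1 / 2)
    (c : V → Fin K) : ¬ G.IsCliqueColoring c := by
  have hVne : Nonempty V := Fintype.card_pos_iff.1 (hK.trans_le hKV)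
  have hKne : Nonempty (Fin K) := ⟨⟨0, hK⟩⟩
  have hmin : ∀ i : Fin K, ∃ v₀ : V, ∀ v,
      (Finset.univ.filter fun u => c u = i ∧ ¬ G.Adj v₀ u).card ≤
      (Finset.univ.filter fun u => c u = i ∧ ¬ G.Adj v u).card := fun i => Finite.exists_min _
  choose m hm using hmin
  -- Different colours may have the same minimizer, so their set is padded to size exactly `K`.
  obtain ⟨S, hS1, -, hS2⟩ := Finset.exists_subsuperset_card_eq
    (Finset.subset_univ (Finset.univ.image m))
    (Finset.card_image_le.trans (by simp)) (by simpa using hKV : K ≤ (Finset.univ : Finset V).card)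
  obtain ⟨i, -, hi⟩ := Finset.exists_le_card_fiber_of_mul_le_card_of_maps_to
    (s := Finset.univ.filter fun w => w ∉ S ∧ ∀ v ∈ S, ¬ G.Adj w v) (t := Finset.univ) (f := c)
    (n := (r + t) * p) (fun _ _ => Finset.mem_univ _) Finset.univ_nonempty
    (by simpa using h1 S hS2)
  have hA : ∀ v, (r + t) * p ≤ ((Finset.univ.filter fun u => c u = i).filter
      fun u => ¬ G.Adj v u).card := by
    intro v
    rw [Finset.filter_filter]
    refine hi.trans (le_trans (Finset.card_le_card fun u hu => ?_) (hm i v))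
    simp only [Finset.mem_filter, Finset.mem_univ, true_and] at hu ⊢
    exact ⟨hu.2, fun h => hu.1.2 (m i) (hS1 (by simp)) h.symm⟩
  obtain ⟨x, hx, hxA, hdom⟩ := exists_parts G h2 _ hA
  obtain ⟨y, hy, hyd⟩ := h4 x hx (two_mul_sum_prod_degree_le G b T hb hp h3 h5 x hx hdom)
  exact not_isCliqueColoring_of_undominated hx (by simpa using hrt)
    (fun z => (Finset.mem_filter.1 (hxA z)).2) hy hyd

end Deterministic

/-! ### Colouring by neighbourhoods and the first moment of bad cliques -/

theorem SimpleGraph.cliqueChromaticNumber_le {V : Type*} [Finite V] {G : SimpleGraph V} {k : ℕ} {c : V → Fin k}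
    (h : G.IsCliqueColoring c) : G.cliqueChromaticNumber ≤ k :=
  Nat.sInf_le ⟨c, h⟩

/-- Colour the neighbourhoods of `k` vertices with `k` colours and the rest with one more. -/
theorem SimpleGraph.cliqueChromaticNumber_le_card_add_one {V : Type*} [Finite V]
    (G : SimpleGraph V) (S : Finset V)
    (h : ∀ K : Finset V, 2 ≤ K.card → G.IsClique K → Disjoint K S →
      (∀ u ∈ K, ∀ v ∈ S, ¬ G.Adj u v) → ∃ w, w ∉ K ∧ ∀ u ∈ K, G.Adj w u) :
    G.cliqueChromaticNumber ≤ S.card + 1 := by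
  classical
  set c : V → Fin (S.card + 1) := fun u =>
    if hu : ∃ v : S, G.Adj v u then (S.equivFin hu.choose).castSucc else Fin.last _ with hc
  refine SimpleGraph.cliqueChromaticNumber_le (c := c) fun K hK hK2 ⟨a, ha⟩ => ?_
  have hext : ∀ w, w ∉ K → (∀ u ∈ K, G.Adj w u) → False := fun w hw hadj => by
    have : G.IsClique (insert w K) :=
      SimpleGraph.isClique_insert.2 ⟨hK.prop, fun u hu _ => hadj u hu⟩
    exact hw (hK.le_of_ge this (Set.subset_insert w K) (Set.mem_insert w K))
  induction a using Fin.lastCases with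
  | last =>
    have hno : ∀ u ∈ K, ∀ v ∈ S, ¬ G.Adj v u := by
      intro u hu v hv hadj
      have h1 := ha u hu
      have hex : ∃ v : S, G.Adj v u := ⟨⟨v, hv⟩, hadj⟩
      simp only [hc, dif_pos hex] at h1
      exact Fin.castSucc_ne_last _ h1
    suffices hw : ∃ w, w ∉ K.toFinite.toFinset ∧ ∀ u ∈ K.toFinite.toFinset, G.Adj w u by
      obtain ⟨w, hw, hw'⟩ := hw
      exact hext w (by simpa using hw) (by simpa using hw')
    refine h K.toFinite.toFinset ?_ (by simpa using hK.prop) ?_ ?_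
    · refine Finset.one_lt_card_iff_nontrivial.2 ?_
      rwa [Finset.Nontrivial, Set.Finite.coe_toFinset]
    -- A member of `S` in the clique would be adjacent to another clique vertex, which then would
    -- not have the last colour.
    · refine Finset.disjoint_left.2 fun u hu huS => ?_
      have hu' : u ∈ K := by simpa using hu
      obtain ⟨w, hw, hwu⟩ := hK2.exists_ne u
      exact hno w hw u huS (hK.prop hu' hw hwu.symm)
    · intro u hu v hv hadj
      exact hno u (by simpa using hu) v hv hadj.symm
  | cast i =>
    have hadj : ∀ u ∈ K, G.Adj (S.equivFin.symm i) u := by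
      intro u hu
      have h1 := ha u hu
      by_cases hex : ∃ v : S, G.Adj v u
      · simp only [hc, dif_pos hex] at h1
        rw [← Fin.castSucc_injective _ h1, Equiv.symm_apply_apply]
        exact hex.choose_spec
      · simp only [hc, dif_neg hex] at h1
        exact absurd h1.symm (Fin.castSucc_ne_last _)
    exact hext _ (fun hmem => G.loopless.irrefl _ (hadj _ hmem)) hadj

section UpperBound
variable {V : Type*} [Fintype V] [DecidableEq V]

theorem bitAvg_one_sub_prod_star {K : Finset V} (w : V) :
    bitAvg (fun ω : Sym2 V → Bool => 1 - ∏ u ∈ K, if ω s(w, u) = true then (1 : ℝ) else 0) =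
      1 - (1 / 2) ^ K.card := by
  have h1 := bitAvg_prod_coord K (fun v => s(w, v)) (fun a _ b _ h => Sym2.congr_right.1 h)
    (fun b => if b = true then (1 : ℝ) else 0)
  rw [bitAvg_sub, bitAvg_const, h1]; norm_num

/-- The three conditions use disjoint sets of coins: pairs between `K` and `S`, pairs inside `K`,
and pairs from `K` to the remaining vertices. Extension by vertices of `S` is ignored, which only
enlarges the event. -/
theorem bitProb_isolated_maximal_clique_le {S K : Finset V} (hKS : Disjoint K S) :
    bitProb (fun ω : Sym2 V → Bool => (bitGraph ω).IsClique K ∧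
      (∀ u ∈ K, ∀ v ∈ S, ¬ (bitGraph ω).Adj u v) ∧
      ∀ w, w ∉ K → ∃ u ∈ K, ¬ (bitGraph ω).Adj w u) ≤
    (1 / 2) ^ (S.card * K.card) * ((1 / 2) ^ K.card.choose 2 *
      (1 - (1 / 2) ^ K.card) ^ (Fintype.card V - S.card - K.card)) := by
  set f₁ : (Sym2 V → Bool) → ℝ := fun ω => ∏ u ∈ K, ∏ v ∈ S, if ω s(u, v) = true then 0 else 1
    with hf₁
  set g : V → (Sym2 V → Bool) → ℝ := fun w ω =>
    1 - ∏ u ∈ K, if ω s(w, u) = true then (1 : ℝ) else 0 with hg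
  set f₃ : (Sym2 V → Bool) → ℝ := fun ω => ∏ w ∈ (S ∪ K)ᶜ, g w ω with hf₃
  have hd1 : DependsOn f₁ {e | ∃ u ∈ K, ∃ v ∈ S, e = s(u, v)} := by
    intro x y hxy
    exact Finset.prod_congr rfl fun u hu => Finset.prod_congr rfl fun v hv => by
      rw [hxy _ ⟨u, hu, v, hv, rfl⟩]
  have hdg : ∀ w, DependsOn (g w) {e | ∃ u ∈ K, e = s(w, u)} := by
    intro w x y hxy
    simp only [hg]
    congr 1
    exact Finset.prod_congr rfl fun v hv => by rw [hxy _ ⟨v, hv, rfl⟩]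
  have hd3 : DependsOn f₃ (⋃ w ∈ (S ∪ K)ᶜ, {e | ∃ u ∈ K, e = s(w, u)}) :=
    dependsOn_prod _ _ g fun w _ => hdg w
  have hd23 : DependsOn (fun ω => allTrue (pairs K) ω * f₃ ω)
      ((pairs K : Set (Sym2 V)) ∪ ⋃ w ∈ (S ∪ K)ᶜ, {e | ∃ u ∈ K, e = s(w, u)}) := by
    intro x y hxy
    dsimp only
    rw [dependsOn_allTrue (pairs K) fun e he => hxy e (Or.inl he),
      hd3 fun e he => hxy e (Or.inr he)]
  have hdisj3 : (((S ∪ K)ᶜ : Finset V) : Set V).PairwiseDisjoint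
      fun w => {e : Sym2 V | ∃ u ∈ K, e = s(w, u)} := by
    intro w hw w' hw' hne
    refine Set.disjoint_left.2 ?_
    rintro e ⟨v, hv, rfl⟩ ⟨v', hv', he⟩
    rcases Sym2.eq_iff.1 he with ⟨h, -⟩ | ⟨h, -⟩
    · exact hne h
    · exact (Finset.mem_compl.1 (Finset.mem_coe.1 hw)) (Finset.mem_union_right _ (h ▸ hv'))
  have hdisj23 : Disjoint (pairs K : Set (Sym2 V))
      (⋃ w ∈ (S ∪ K)ᶜ, {e | ∃ u ∈ K, e = s(w, u)}) := by
    refine Set.disjoint_left.2 fun e he he' => ?_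
    simp only [Set.mem_iUnion] at he'
    obtain ⟨w, hw, u, hu, rfl⟩ := he'
    exact Finset.mem_compl.1 hw (Finset.mem_union_right _ (mem_pairs.1 (Finset.mem_coe.1 he)).1)
  have hdisj1 : Disjoint {e | ∃ u ∈ K, ∃ v ∈ S, e = s(u, v)} ((pairs K : Set (Sym2 V)) ∪
      ⋃ w ∈ (S ∪ K)ᶜ, {e | ∃ u ∈ K, e = s(w, u)}) := by
    refine Set.disjoint_left.2 ?_
    rintro e ⟨u, hu, v, hv, rfl⟩ (he | he)
    · exact Finset.disjoint_left.1 hKS (mem_pairs.1 (Finset.mem_coe.1 he)).2.1 hv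
    · simp only [Set.mem_iUnion] at he
      obtain ⟨w, hw, u', hu', he⟩ := he
      rw [Finset.mem_compl, Finset.mem_union, not_or] at hw
      rcases Sym2.eq_iff.1 he with ⟨h, -⟩ | ⟨-, h⟩
      · exact hw.2 (h ▸ hu)
      · exact hw.1 (h ▸ hv)
  have hcard : (S ∪ K)ᶜ.card = Fintype.card V - S.card - K.card := by
    rw [Finset.card_compl, Finset.card_union_of_disjoint hKS.symm, Nat.sub_add_eq]
  have e1 : bitAvg f₁ = (1 / 2) ^ (S.card * K.card) := by
    rw [hf₁, bitAvg_prod_star hKS (fun b => if b = true then (0 : ℝ) else 1), ← pow_mul]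
    norm_num
  have e3 : bitAvg f₃ = (1 - (1 / 2) ^ K.card) ^ (Fintype.card V - S.card - K.card) := by
    rw [hf₃, bitAvg_prod _ _ g (fun w _ => hdg w) hdisj3, ← hcard]
    refine Finset.prod_eq_pow_card fun w _ => bitAvg_one_sub_prod_star w
  rw [← e1, ← e3, ← card_pairs, ← bitAvg_allTrue,
    ← bitAvg_mul_of_dependsOn hdisj23 (dependsOn_allTrue _) hd3,
    ← bitAvg_mul_of_dependsOn hdisj1 hd1 hd23]
  have hg0 : ∀ w ω, 0 ≤ g w ω := fun w ω => by
    rw [hg]; dsimp only; rw [Finset.prod_ite_zero]; split_ifs <;> simp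
  refine bitProb_le_bitAvg (fun ω => ?_) fun ω hω => ?_
  · exact mul_nonneg (Finset.prod_nonneg fun _ _ => Finset.prod_nonneg fun _ _ => by
      split_ifs <;> norm_num) (mul_nonneg (allTrue_nonneg _ _)
        (Finset.prod_nonneg fun _ _ => hg0 _ _))
  · obtain ⟨h1, h2, h3⟩ := hω
    have a1 : f₁ ω = 1 := Finset.prod_eq_one fun u hu => Finset.prod_eq_one fun v hv => by
      rw [if_neg]
      exact fun h => h2 u hu v hv ⟨fun e => Finset.disjoint_left.1 hKS hu (e ▸ hv), h⟩
    have a2 : allTrue (pairs K) ω = 1 := if_pos ((forall_pairs_iff_isClique K ω).2 h1)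
    have a3 : f₃ ω = 1 := Finset.prod_eq_one fun w hw => by
      rw [Finset.mem_compl, Finset.mem_union, not_or] at hw
      obtain ⟨u, hu, hwu⟩ := h3 w hw.2
      rw [hg]; dsimp only
      rw [Finset.prod_eq_zero hu, sub_zero]
      rw [if_neg]
      exact fun h => hwu ⟨fun e => hw.2 (e ▸ hu), h⟩
    rw [a1, a2, a3]; norm_num

/-- A first-moment bound over the cliques that spoil the colouring by neighbourhoods of the fixed
set `S`. -/
theorem bitProb_card_add_one_lt_cliqueChromaticNumber_le (S : Finset V) :
    bitProb (fun ω : Sym2 V → Bool => S.card + 1 < (bitGraph ω).cliqueChromaticNumber) ≤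
    ∑ s ∈ Finset.Icc 2 (Fintype.card V), ((Fintype.card V).choose s : ℝ) *
      ((1 / 2) ^ (S.card * s) * ((1 / 2) ^ s.choose 2 *
        (1 - (1 / 2) ^ s) ^ (Fintype.card V - S.card - s))) := by
  set I := (Finset.univ : Finset (Finset V)).filter fun K => 2 ≤ K.card ∧ Disjoint K S with hI
  calc _ ≤ bitProb (fun ω : Sym2 V → Bool => ∃ K ∈ I, (bitGraph ω).IsClique K ∧
      (∀ u ∈ K, ∀ v ∈ S, ¬ (bitGraph ω).Adj u v) ∧
      ∀ w, w ∉ K → ∃ u ∈ K, ¬ (bitGraph ω).Adj w u) := by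
        refine bitProb_mono fun ω hω => ?_
        by_contra hcon
        refine absurd (SimpleGraph.cliqueChromaticNumber_le_card_add_one (bitGraph ω) S
          fun K hK hcl hd hn => ?_) (not_le.2 hω)
        by_contra hw
        push Not at hw
        exact hcon ⟨K, by simp [hI, hK, hd], hcl, hn, hw⟩
    _ ≤ ∑ K ∈ I, _ := bitProb_exists_le _ _
    _ ≤ ∑ K ∈ I, ((1 / 2 : ℝ) ^ (S.card * K.card) * ((1 / 2) ^ K.card.choose 2 *
        (1 - (1 / 2) ^ K.card) ^ (Fintype.card V - S.card - K.card))) :=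
        Finset.sum_le_sum fun K hK =>
          bitProb_isolated_maximal_clique_le (Finset.mem_filter.1 hK).2.2
    _ = ∑ s ∈ Finset.Icc 2 (Fintype.card V), ∑ K ∈ I with K.card = s,
        ((1 / 2 : ℝ) ^ (S.card * K.card) * ((1 / 2) ^ K.card.choose 2 *
        (1 - (1 / 2) ^ K.card) ^ (Fintype.card V - S.card - K.card))) :=
        (Finset.sum_fiberwise_of_maps_to (fun K hK => Finset.mem_Icc.2
          ⟨(Finset.mem_filter.1 hK).2.1, K.card_le_univ⟩) _).symm
    _ ≤ _ := by
        refine Finset.sum_le_sum fun s _ => ?_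
        rw [Finset.sum_congr rfl (g := fun _ => ((1 / 2 : ℝ) ^ (S.card * s) *
          ((1 / 2) ^ s.choose 2 * (1 - (1 / 2) ^ s) ^ (Fintype.card V - S.card - s))))
          (fun K hK => by rw [(Finset.mem_filter.1 hK).2]), Finset.sum_const, nsmul_eq_mul]
        have h01 : (0 : ℝ) ≤ 1 - (1 / 2) ^ s :=
          sub_nonneg.2 (pow_le_one₀ (by norm_num) (by norm_num))
        gcongr
        rw [← Finset.card_univ (α := V), ← Finset.card_powersetCard]
        exact Finset.card_le_card fun K hK =>
          Finset.mem_powersetCard.2 ⟨Finset.subset_univ _, (Finset.mem_filter.1 hK).2⟩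

end UpperBound

/-! ### From coin flips to the binomial random graph -/

section Transfer

theorem bitGraph_eq_iff {V : Type*} (ω : Sym2 V → Bool) (G : SimpleGraph V) :
    bitGraph ω = G ↔ ∀ e : Sym2 V, ¬ e.IsDiag → (ω e = true ↔ e ∈ G.edgeSet) := by
  constructor
  · rintro rfl e
    induction e with | _ u v
    intro h
    rw [Sym2.mk_isDiag_iff] at h
    simp [bitGraph, h]
  · intro h
    ext u v
    by_cases huv : u = v
    · subst huv; simp
    · have := h s(u, v) (by simpa using huv)
      simp only [bitGraph, SimpleGraph.mem_edgeSet] at this ⊢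
      rw [← this]
      exact and_iff_right huv

/-- Coins on diagonal pairs do not affect the graph and all others are determined by it, so every
graph has equally many encodings. -/
theorem card_filter_bitGraph_eq {V : Type*} [Fintype V] [DecidableEq V] (G : SimpleGraph V)
    [DecidablePred fun ω : Sym2 V → Bool => bitGraph ω = G] :
    (Finset.univ.filter fun ω : Sym2 V → Bool => bitGraph ω = G).card =
      2 ^ Fintype.card {e : Sym2 V // e.IsDiag} := by
  classical
  have : (Finset.univ.filter fun ω : Sym2 V → Bool => bitGraph ω = G) =
      Fintype.piFinset fun e => if e.IsDiag then Finset.univ else {decide (e ∈ G.edgeSet)} := by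
    ext ω
    simp only [Finset.mem_filter, Finset.mem_univ, true_and, Fintype.mem_piFinset,
      bitGraph_eq_iff]
    refine forall_congr' fun e => ?_
    by_cases h : e.IsDiag
    · simp [h]
    · simp only [h, not_false_eq_true, true_imp_iff, if_false, Finset.mem_singleton]
      by_cases hm : e ∈ G.edgeSet <;> simp [hm]
  rw [this, Fintype.card_piFinset]
  have h2 : ∀ e : Sym2 V, (if e.IsDiag then (Finset.univ : Finset Bool)
      else {decide (e ∈ G.edgeSet)}).card = if e.IsDiag then 2 else 1 := fun e => by
    split_ifs <;> simp
  simp only [h2]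
  rw [Finset.prod_ite, Finset.prod_const, Finset.prod_const_one, mul_one, Fintype.card_subtype]

theorem binomialRandom_half_eq_bitProb {V : Type*} [Fintype V] [DecidableEq V]
    (Q : SimpleGraph V → Prop) :
    SimpleGraph.binomialRandom V edgeProbHalf {G | Q G} =
      ENNReal.ofReal (bitProb fun ω : Sym2 V → Bool => Q (bitGraph ω)) := by
  classical
  have hfin : Fintype (SimpleGraph V) := Fintype.ofFinite _
  set N := (Fintype.card V).choose 2
  have hsingle : ∀ G : SimpleGraph V, SimpleGraph.binomialRandom V edgeProbHalf {G} =
      ENNReal.ofReal ((1 / 2) ^ N) := by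
    intro G
    rw [SimpleGraph.binomialRandom_singleton]
    have h1 : (unitInterval.toNNReal edgeProbHalf : ENNReal) = ENNReal.ofReal (1 / 2) := by
      rw [ENNReal.ofReal]; congr 1
      ext; simp [edgeProbHalf]
    have h2 : (unitInterval.toNNReal (unitInterval.symm edgeProbHalf) : ENNReal) =
        ENNReal.ofReal (1 / 2) := by
      rw [ENNReal.ofReal]; congr 1
      ext; simp [edgeProbHalf]; norm_num
    have hle : G.edgeSet.ncard ≤ N := by
      rw [← G.coe_edgeFinset, Set.ncard_coe_finset]
      exact G.card_edgeFinset_le_card_choose_two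
    rw [h1, h2, ← pow_add, Nat.card_eq_fintype_card, Nat.add_sub_cancel' hle,
      ENNReal.ofReal_pow (by norm_num)]
  have hcount : bitProb (fun ω : Sym2 V → Bool => Q (bitGraph ω)) =
      (Finset.univ.filter Q).card * (1 / 2) ^ N := by
    rw [bitProb, bitAvg, Finset.sum_boole,
      Finset.card_eq_sum_card_fiberwise (f := bitGraph) (t := Finset.univ.filter Q)
        (fun ω hω => by simpa using hω)]
    have hfib : ∀ G ∈ Finset.univ.filter Q, ((Finset.univ.filter
        fun ω : Sym2 V → Bool => Q (bitGraph ω)).filter fun ω => bitGraph ω = G).card =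
          2 ^ Fintype.card {e : Sym2 V // e.IsDiag} := by
      intro G hG
      rw [← card_filter_bitGraph_eq G, Finset.filter_filter]
      congr 1
      refine Finset.filter_congr fun ω _ => ⟨fun h => h.2, fun h => ⟨?_, h⟩⟩
      rw [h]; exact (Finset.mem_filter.1 hG).2
    rw [Finset.sum_congr rfl hfib, Finset.sum_const, smul_eq_mul]
    have hsplit : Fintype.card (Sym2 V) = Fintype.card {e : Sym2 V // e.IsDiag} + N := by
      rw [Sym2.card_subtype_diag, Sym2.card, Nat.choose_succ_left _ _ (by norm_num)]
      simp [N]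
    rw [hsplit, pow_add]
    push_cast
    field_simp
    rw [mul_assoc, ← mul_pow]; norm_num
  have hms : MeasurableSingletonClass (SimpleGraph V) := ⟨fun G => by
    have h := SimpleGraph.measurable_edgeSet (V := V) (measurableSet_singleton G.edgeSet)
    convert h using 1
    ext H; simp⟩
  rw [hcount, show {G | Q G} = ((Finset.univ.filter Q : Finset (SimpleGraph V)) : Set _) by
    ext; simp, ← MeasureTheory.sum_measure_singleton, Finset.sum_congr rfl fun G _ => hsingle G,
    Finset.sum_const, nsmul_eq_mul, ENNReal.ofReal_mul (by positivity), ENNReal.ofReal_natCast]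

theorem bitProb_not {E : Type*} [Fintype E] [DecidableEq E] (A : (E → Bool) → Prop) :
    bitProb (fun ω => ¬ A ω) = 1 - bitProb A := by
  classical
  rw [eq_sub_iff_add_eq, bitProb, bitProb, ← bitAvg_add]
  refine Eq.trans ?_ (bitAvg_const (E := E) 1)
  congr 1
  funext ω
  by_cases h : A ω <;> simp [h]

theorem whp_iff {Q : (n : ℕ) → SimpleGraph (Fin n) → Prop} :
    Whp Q ↔ Tendsto (fun n => bitProb fun ω : Sym2 (Fin n) → Bool => ¬ Q n (bitGraph ω))
      atTop (𝓝 0) := by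
  unfold Whp
  simp only [binomialRandom_half_eq_bitProb, bitProb_not]
  rw [show (1 : ENNReal) = ENNReal.ofReal 1 by simp]
  constructor
  · intro h
    have := (ENNReal.tendsto_toReal (by simp)).comp h
    simp only [Function.comp_def, ENNReal.toReal_ofReal (bitProb_nonneg _),
      ENNReal.toReal_ofReal zero_le_one] at this
    simpa using this.const_sub 1
  · intro h
    refine ENNReal.tendsto_ofReal ?_
    simpa using h.const_sub 1

end Transfer

/-! ### Asymptotics of the upper bound -/

theorem choose_le_pow_div_factorial (n s : ℕ) : (n.choose s : ℝ) ≤ n ^ s / s.factorial := by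
  rw [le_div_iff₀ (by positivity)]
  have := Nat.descFactorial_le_pow n s
  rw [Nat.descFactorial_eq_factorial_mul_choose] at this
  exact_mod_cast (by linarith [mul_comm (n.choose s) s.factorial] :
    n.choose s * s.factorial ≤ n ^ s)

theorem inv_factorial_le (s : ℕ) (hs : 0 < s) : 1 / (s.factorial : ℝ) ≤ (Real.exp 1 / s) ^ s := by
  have hs' : (0 : ℝ) < s := by exact_mod_cast hs
  have h := Real.pow_div_factorial_le_exp (s : ℝ) hs'.le s
  rw [div_pow, ← Real.exp_nat_mul, mul_one, div_le_div_iff₀ (by positivity) (by positivity)]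
  rw [div_le_iff₀ (by positivity)] at h
  linarith

theorem half_pow_choose_two (s : ℕ) (hs : 0 < s) :
    (1 / 2 : ℝ) ^ s.choose 2 = Real.sqrt (2 / 2 ^ s) ^ s := by
  refine (pow_left_inj₀ (by positivity) (by positivity) two_ne_zero).1 ?_
  obtain ⟨m, rfl⟩ := Nat.exists_eq_add_of_le' hs
  rw [← pow_mul (Real.sqrt _), mul_comm (m + 1) 2, pow_mul (Real.sqrt _), Real.sq_sqrt
    (by positivity), ← pow_mul, Nat.choose_two_right, Nat.div_mul_cancel
    (Nat.even_mul_pred_self (m + 1)).two_dvd, Nat.add_sub_cancel, mul_comm (m + 1) m, pow_mul]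
  congr 1
  rw [pow_succ]; field_simp
  rw [← mul_pow]; norm_num

theorem one_sub_pow_le_exp {x : ℝ} (hx : x ≤ 1) (m : ℕ) :
    (1 - x) ^ m ≤ Real.exp (-(m * x)) := by
  calc (1 - x) ^ m ≤ Real.exp (-x) ^ m := by
        gcongr
        linarith [Real.add_one_le_exp (-x)]
    _ = _ := by rw [← Real.exp_nat_mul]; ring_nf

/-- The expected number of maximal cliques of size `s` outside `k` neighbourhoods. -/
theorem expected_maximal_cliques_le {n k s : ℕ} {ε l : ℝ} (hε : 0 < ε) (hl : l = Real.log n)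
    (hl1 : 1 ≤ l) (hs : 1 ≤ s)
    (hk : (n : ℝ) * (1 / 2) ^ k ≤ 4 * (Real.sqrt n * l ^ (1 / 2 - ε)))
    (hkn : 4 * k ≤ n) (hln : 8 * l ≤ n)
    (hlog : (1 + ε) * Real.log l ≤ (1 - Real.log 2) * l)
    (hy : ∀ y : ℝ, l ^ (1 + ε) ≤ y → 2 * y ^ (1 / (1 + ε)) * Real.log (6 * y) ≤ y / 4) :
    (n.choose s : ℝ) * ((1 / 2) ^ (k * s) * ((1 / 2) ^ s.choose 2 *
      (1 - (1 / 2) ^ s) ^ (n - k - s))) ≤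
    (16 * l ^ (-(ε / 2))) ^ s + Real.exp (-(l ^ (1 + ε) / 4)) := by
  have hl0 : 0 < l := by linarith
  have hn0 : (0 : ℝ) < n := by linarith
  have hs0 : (0 : ℝ) < s := by exact_mod_cast hs
  set y : ℝ := n / 2 ^ s with hyd
  have hy0 : 0 < y := by positivity
  -- Up to `1 / s!` and the maximality factor, the expected number is `M ^ s`; `y` is about the
  -- expected number of vertices extending a given clique.
  set M : ℝ := n * (1 / 2) ^ k * Real.sqrt (2 / 2 ^ s) with hM
  have hM0 : 0 ≤ M := by positivity
  have hM2 : M ^ 2 ≤ 32 * l ^ (1 - 2 * ε) * y := by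
    rw [hM, mul_pow, Real.sq_sqrt (by positivity)]
    calc ((n : ℝ) * (1 / 2) ^ k) ^ 2 * (2 / 2 ^ s)
        ≤ (4 * (Real.sqrt n * l ^ (1 / 2 - ε))) ^ 2 * (2 / 2 ^ s) := by gcongr
      _ = _ := by
        rw [mul_pow, mul_pow, Real.sq_sqrt hn0.le, ← Real.rpow_natCast (l ^ _), ← Real.rpow_mul
          hl0.le, hyd]
        rw [show (1 / 2 - ε) * ((2 : ℕ) : ℝ) = 1 - 2 * ε by push_cast; ring]
        ring
  have h01 : (0 : ℝ) ≤ 1 - (1 / 2) ^ s := sub_nonneg.2 (pow_le_one₀ (by norm_num) (by norm_num))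
  have hmain : (n.choose s : ℝ) * ((1 / 2) ^ (k * s) * ((1 / 2) ^ s.choose 2 *
      (1 - (1 / 2) ^ s) ^ (n - k - s))) ≤
      M ^ s * (1 / s.factorial) * (1 - (1 / 2) ^ s) ^ (n - k - s) := by
    calc _ ≤ (n : ℝ) ^ s / s.factorial * ((1 / 2) ^ (k * s) * ((1 / 2) ^ s.choose 2 *
      (1 - (1 / 2) ^ s) ^ (n - k - s))) := by
          gcongr; exact choose_le_pow_div_factorial n s
      _ = _ := by
          rw [half_pow_choose_two s hs, hM, mul_pow, mul_pow, ← pow_mul]; ring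
  refine hmain.trans ?_
  -- For small `y` the clique is large, `s ≥ l`, and `1 / s!` beats `M ^ s` since `M` is of order at
  -- most `l ^ (1 - ε / 2)`. For large `y` maximality costs `exp (-y / 2)`, while `M ^ s ≤ exp (y /
  -- 4)` because `s ≤ 2l` and `l < y ^ (1 / (1 + ε))`.
  rcases le_or_gt y (l ^ (1 + ε)) with hcase | hcase
  · refine le_trans ?_ (le_add_of_nonneg_right (Real.exp_pos _).le)
    have hsl : l ≤ s := by
      have h1 : (n : ℝ) ≤ l ^ (1 + ε) * 2 ^ s := by rwa [hyd, div_le_iff₀ (by positivity)] at hcase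
      have h2 := Real.log_le_log hn0 h1
      rw [Real.log_mul (by positivity) (by positivity), Real.log_rpow hl0, Real.log_pow, ← hl] at h2
      have h3 := Real.log_pos (by norm_num : (1 : ℝ) < 2)
      nlinarith
    have hMl : M ≤ Real.sqrt 32 * l ^ (1 - ε / 2) := by
      refine (sq_le_sq₀ hM0 (by positivity)).1 ?_
      rw [mul_pow (Real.sqrt 32), Real.sq_sqrt (by norm_num), ← Real.rpow_natCast (l ^ _), ← Real.rpow_mul hl0.le]
      refine hM2.trans ?_
      calc 32 * l ^ (1 - 2 * ε) * y ≤ 32 * l ^ (1 - 2 * ε) * l ^ (1 + ε) := by gcongr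
        _ = 32 * l ^ ((1 - ε / 2) * (2 : ℕ)) := by
          rw [mul_assoc, ← Real.rpow_add hl0]; congr 2; push_cast; ring
    have hbase : M * (Real.exp 1 / s) ≤ 16 * l ^ (-(ε / 2)) := by
      have hc : Real.sqrt 32 * Real.exp 1 ≤ 16 := by
        have h1 : Real.sqrt 32 ≤ 5.7 := Real.sqrt_le_iff.2 ⟨by norm_num, by norm_num⟩
        have h2 := Real.exp_one_lt_d9
        nlinarith [Real.exp_pos 1]
      have e : l ^ (1 - ε / 2) = l * l ^ (-(ε / 2)) := by
        rw [sub_eq_add_neg, Real.rpow_add hl0, Real.rpow_one]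
      calc M * (Real.exp 1 / s) ≤ (Real.sqrt 32 * l ^ (1 - ε / 2)) * (Real.exp 1 / l) := by gcongr
        _ = (Real.sqrt 32 * Real.exp 1) * l ^ (-(ε / 2)) := by rw [e]; field_simp
        _ ≤ _ := by gcongr
    calc M ^ s * (1 / s.factorial) * (1 - (1 / 2) ^ s) ^ (n - k - s)
        ≤ M ^ s * (1 / s.factorial) * 1 := by
          gcongr; exact pow_le_one₀ h01 (by linarith [pow_nonneg (by norm_num : (0:ℝ) ≤ 1/2) s])
      _ ≤ M ^ s * (Real.exp 1 / s) ^ s * 1 := by gcongr; exact inv_factorial_le s hs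
      _ = (M * (Real.exp 1 / s)) ^ s := by rw [mul_one, ← mul_pow M]
      _ ≤ _ := by gcongr
  · refine le_trans ?_ (le_add_of_nonneg_left (by positivity))
    have hly : l ≤ l ^ (1 + ε) := by
      conv_lhs => rw [← Real.rpow_one l]
      exact Real.rpow_le_rpow_of_exponent_le hl1 (by linarith)
    have hy1 : 1 ≤ y := by linarith
    have hs2l : (s : ℝ) ≤ 2 * l := by
      have h1 : (2 : ℝ) ^ s ≤ n := by
        rwa [hyd, le_div_iff₀ (by positivity), one_mul] at hy1
      have h2 := Real.log_le_log (by positivity) h1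
      rw [Real.log_pow, ← hl] at h2
      have h3 := Real.log_two_gt_d9
      nlinarith
    have hM6 : M ≤ 6 * y := by
      refine (sq_le_sq₀ hM0 (by positivity)).1 ?_
      have : l ^ (1 - 2 * ε) ≤ l := by
        conv_rhs => rw [← Real.rpow_one l]
        exact Real.rpow_le_rpow_of_exponent_le hl1 (by linarith)
      calc M ^ 2 ≤ 32 * l ^ (1 - 2 * ε) * y := hM2
        _ ≤ 32 * y * y := by gcongr; linarith
        _ ≤ _ := by nlinarith
    have hexp : (1 - (1 / 2 : ℝ) ^ s) ^ (n - k - s) ≤ Real.exp (-(y / 2)) := by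
      refine (one_sub_pow_le_exp (pow_le_one₀ (by norm_num) (by norm_num)) _).trans
        (Real.exp_le_exp.2 (neg_le_neg ?_))
      have hks : k + s ≤ n := by
        have : 4 * (s : ℝ) ≤ n := by linarith
        have : 4 * s ≤ n := by exact_mod_cast this
        omega
      have : ((n - k - s : ℕ) : ℝ) = n - k - s := by
        rw [Nat.sub_sub, Nat.cast_sub hks]; push_cast; ring
      rw [this, hyd, one_div, inv_pow, ← div_eq_mul_inv, div_div, div_le_div_iff₀ (by positivity)
        (by positivity)]
      have hk' : 4 * (k : ℝ) ≤ n := by exact_mod_cast hkn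
      have : (0 : ℝ) < 2 ^ s := by positivity
      nlinarith
    have hy6 : 0 ≤ Real.log (6 * y) := Real.log_nonneg (by linarith)
    have hpow : M ^ s ≤ Real.exp (y / 4) := by
      calc M ^ s ≤ (6 * y) ^ s := by gcongr
        _ = Real.exp (s * Real.log (6 * y)) := by
          rw [Real.exp_nat_mul, Real.exp_log (by positivity)]
        _ ≤ _ := by
          rw [Real.exp_le_exp]
          refine le_trans ?_ (hy y hcase.le)
          gcongr
          refine hs2l.trans ?_
          gcongr
          rw [← Real.rpow_le_rpow_iff (z := 1 + ε) hl0.le (by positivity) (by linarith),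
            ← Real.rpow_mul hy0.le, one_div_mul_cancel (by linarith), Real.rpow_one]
          exact hcase.le
    calc M ^ s * (1 / s.factorial) * (1 - (1 / 2) ^ s) ^ (n - k - s)
        ≤ Real.exp (y / 4) * 1 * Real.exp (-(y / 2)) := by
          gcongr
          rw [div_le_one (by positivity)]
          exact_mod_cast s.factorial_pos
      _ = Real.exp (-(y / 4)) := by rw [mul_one, ← Real.exp_add]; ring_nf
      _ ≤ _ := Real.exp_le_exp.2 (by linarith)

theorem tendsto_log_nat : Tendsto (fun n : ℕ => Real.log n) atTop atTop :=
  Real.tendsto_log_atTop.comp tendsto_natCast_atTop_atTop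

/-- With high probability few colours suffice. -/
theorem tendsto_bitProb_upper {ε : ℝ} (hε : 0 < ε) :
    Tendsto (fun n : ℕ => bitProb fun ω : Sym2 (Fin n) → Bool =>
      ¬ (((bitGraph ω).cliqueChromaticNumber : ℝ) ≤ 1 / 2 * Real.logb 2 n -
        (1 / 2 - ε) * Real.logb 2 (Real.log n))) atTop (𝓝 0) := by
  have hlog2 := Real.log_pos (by norm_num : (1 : ℝ) < 2)
  have hbound : ∀ᶠ n : ℕ in atTop, bitProb (fun ω : Sym2 (Fin n) → Bool =>
      ¬ (((bitGraph ω).cliqueChromaticNumber : ℝ) ≤ 1 / 2 * Real.logb 2 n -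
        (1 / 2 - ε) * Real.logb 2 (Real.log n))) ≤
      2 * (16 * (Real.log n) ^ (-(ε / 2))) +
        Real.exp (Real.log n - (Real.log n) ^ (1 + ε) / 4) := by
    have E1 : ∀ᶠ l : ℝ in atTop, 1 ≤ l := eventually_ge_atTop 1
    have E2 : ∀ᶠ l : ℝ in atTop, 8 * l ≤ Real.exp l := by
      have := (Real.isLittleO_pow_exp_atTop (n := 1)).bound (by norm_num : (0 : ℝ) < 1 / 8)
      filter_upwards [this, eventually_ge_atTop 0] with l h1 h2
      simp only [pow_one, Real.norm_eq_abs, abs_of_nonneg h2, abs_of_pos (Real.exp_pos _)] at h1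
      linarith
    have E3 : ∀ᶠ l : ℝ in atTop, (1 + ε) * Real.log l ≤ (1 - Real.log 2) * l := by
      have h2 : Real.log 2 < 1 := by linarith [Real.log_two_lt_d9]
      have := Real.isLittleO_log_id_atTop.bound
        (show 0 < (1 - Real.log 2) / (1 + ε) from div_pos (by linarith) (by linarith))
      filter_upwards [this, eventually_ge_atTop 1] with l h1 h3
      simp only [id, Real.norm_eq_abs, abs_of_nonneg (by linarith : 0 ≤ l)] at h1
      have h4 := (le_abs_self _).trans h1
      rw [div_mul_eq_mul_div, le_div_iff₀ (by linarith)] at h4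
      linarith
    have E4 : ∀ᶠ l : ℝ in atTop, ∀ y : ℝ, l ^ (1 + ε) ≤ y →
        2 * y ^ (1 / (1 + ε)) * Real.log (6 * y) ≤ y / 4 := by
      set δ := 1 - 1 / (1 + ε) with hδ
      have hδ0 : 0 < δ := by
        rw [hδ, sub_pos, div_lt_one (by linarith)]; linarith
      have h1 : ∀ᶠ y : ℝ in atTop, 2 * y ^ (1 / (1 + ε)) * Real.log (6 * y) ≤ y / 4 := by
        have h2 := (isLittleO_log_rpow_atTop hδ0).bound (by norm_num : (0 : ℝ) < 1 / 16)
        have h3 := (tendsto_rpow_atTop hδ0).eventually_ge_atTop (16 * Real.log 6)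
        filter_upwards [h2, h3, eventually_ge_atTop 1] with y h2 h3 hy1
        have hy0 : 0 < y := by linarith
        rw [Real.norm_eq_abs, Real.norm_eq_abs, abs_of_nonneg (Real.log_nonneg hy1),
          abs_of_pos (by positivity)] at h2
        have e : y = y ^ (1 / (1 + ε)) * y ^ δ := by
          rw [← Real.rpow_add hy0, hδ]; simp
        rw [Real.log_mul (by norm_num) hy0.ne']
        have : Real.log 6 + Real.log y ≤ y ^ δ / 8 := by linarith
        calc 2 * y ^ (1 / (1 + ε)) * (Real.log 6 + Real.log y)
            ≤ 2 * y ^ (1 / (1 + ε)) * (y ^ δ / 8) := by gcongr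
          _ = (y ^ (1 / (1 + ε)) * y ^ δ) / 4 := by ring
          _ = y / 4 := by rw [← e]
      obtain ⟨Y, hY⟩ := eventually_atTop.1 h1
      filter_upwards [(tendsto_rpow_atTop (by linarith : 0 < 1 + ε)).eventually_ge_atTop Y]
        with l hl y hy
      exact hY y (hl.trans hy)
    have E5 : ∀ᶠ l : ℝ in atTop, 16 * l ^ (-(ε / 2)) ≤ 1 / 2 := by
      have := ((tendsto_rpow_neg_atTop (by linarith : 0 < ε / 2)).const_mul 16)
      rw [mul_zero] at this
      exact this.eventually_le_const (by norm_num)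
    have E6 : ∀ᶠ l : ℝ in atTop, 2 ≤ 1 / 2 * (l / Real.log 2) -
        (1 / 2 - ε) * (Real.log l / Real.log 2) := by
      have := Real.isLittleO_log_id_atTop.bound (by norm_num : (0 : ℝ) < 1 / 2)
      filter_upwards [this, eventually_ge_atTop 1, eventually_ge_atTop (8 * Real.log 2)]
        with l h1 h3 h5
      simp only [id, Real.norm_eq_abs, abs_of_nonneg (by linarith : 0 ≤ l)] at h1
      have h4 := (le_abs_self _).trans h1
      have h6 := Real.log_nonneg h3
      have e : 1 / 2 * (l / Real.log 2) - (1 / 2 - ε) * (Real.log l / Real.log 2) =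
        (1 / 2 * l - (1 / 2 - ε) * Real.log l) / Real.log 2 := by ring
      rw [e, le_div_iff₀ hlog2]
      nlinarith
    have E7 : ∀ᶠ l : ℝ in atTop, 1 / 2 * (l / Real.log 2) -
        (1 / 2 - ε) * (Real.log l / Real.log 2) ≤ Real.exp l / 4 := by
      have h8 := Real.isLittleO_log_id_atTop.bound
        (show 0 < 1 / (2 * (1 + ε)) by positivity)
      filter_upwards [h8, E1, E2] with l h1 h3 h5
      simp only [id, Real.norm_eq_abs, abs_of_nonneg (by linarith : 0 ≤ l)] at h1
      have h4 := (le_abs_self _).trans h1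
      rw [div_mul_eq_mul_div, le_div_iff₀ (by positivity)] at h4
      have h6 := Real.log_nonneg h3
      have e : 1 / 2 * (l / Real.log 2) - (1 / 2 - ε) * (Real.log l / Real.log 2) =
        (1 / 2 * l - (1 / 2 - ε) * Real.log l) / Real.log 2 := by ring
      rw [e, div_le_iff₀ hlog2]
      have h7 := Real.log_two_gt_d9
      nlinarith
    filter_upwards [eventually_ge_atTop 1, tendsto_log_nat.eventually (E1.and (E2.and (E3.and (E4.and (E5.and (E6.and E7))))))]
      with n hn ⟨h1, h2, h3, h4, h5, h6, h7⟩
    have hn0 : (0 : ℝ) < n := by exact_mod_cast hn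
    rw [Real.exp_log hn0] at h2 h7
    set l := Real.log n with hl
    have hl0 : 0 < l := by linarith
    set B := 1 / 2 * Real.logb 2 n - (1 / 2 - ε) * Real.logb 2 l with hB
    have hB' : 1 / 2 * (l / Real.log 2) - (1 / 2 - ε) * (Real.log l / Real.log 2) = B := rfl
    rw [hB'] at h6 h7
    -- One colour is reserved for vertices without neighbours in `S`, so `k = ⌊B⌋₊ - 1`. Then `k > B
    -- - 2`, whence the factor `4 = 2²` in `hkk`.
    obtain ⟨k, hk⟩ : ∃ k, ⌊B⌋₊ = k + 1 := Nat.exists_eq_add_of_le' (Nat.le_floor (by push_cast; linarith))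
    have hkB : (k : ℝ) + 1 ≤ B := by
      have := Nat.floor_le (by linarith : 0 ≤ B)
      rw [hk] at this; exact_mod_cast this
    have hBk : B < k + 2 := by
      have := Nat.lt_floor_add_one B
      rw [hk] at this; push_cast at this; linarith
    have hkn : 4 * k ≤ n := by
      have : 4 * (k : ℝ) ≤ n := by linarith
      exact_mod_cast this
    obtain ⟨S, -, hS⟩ := Finset.exists_subset_card_eq
      (show k ≤ (Finset.univ : Finset (Fin n)).card by simp; omega)
    have hkk : (n : ℝ) * (1 / 2) ^ k ≤ 4 * (Real.sqrt n * l ^ (1 / 2 - ε)) := by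
      have e1 : ((1 : ℝ) / 2) ^ k = (2 : ℝ) ^ (-(k : ℝ)) := by
        rw [Real.rpow_neg (by norm_num), Real.rpow_natCast]; simp
      have e2 : (2 : ℝ) ^ (2 - B) = 4 * ((Real.sqrt n)⁻¹ * l ^ (1 / 2 - ε)) := by
        have a1 : (2 : ℝ) ^ (-(1 / 2 * Real.logb 2 n)) = (Real.sqrt n)⁻¹ := by
          rw [Real.rpow_neg (by norm_num), mul_comm, Real.rpow_mul (by norm_num),
            Real.rpow_logb (by norm_num) (by norm_num) hn0, Real.sqrt_eq_rpow]
        have a2 : (2 : ℝ) ^ ((1 / 2 - ε) * Real.logb 2 l) = l ^ (1 / 2 - ε) := by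
          rw [mul_comm, Real.rpow_mul (by norm_num),
            Real.rpow_logb (by norm_num) (by norm_num) hl0]
        rw [← a1, ← a2, ← Real.rpow_add (by norm_num), show (4 : ℝ) = (2 : ℝ) ^ (2 : ℝ) by norm_num,
          ← Real.rpow_add (by norm_num)]
        congr 1; rw [hB]; ring
      have e3 : (n : ℝ) * (Real.sqrt n)⁻¹ = Real.sqrt n := by
        rw [← div_eq_mul_inv, Real.div_sqrt]
      calc (n : ℝ) * (1 / 2) ^ k ≤ n * (2 : ℝ) ^ (2 - B) := by
            rw [e1]; gcongr
            · norm_num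
            · linarith
        _ = 4 * ((n * (Real.sqrt n)⁻¹) * l ^ (1 / 2 - ε)) := by rw [e2]; ring
        _ = _ := by rw [e3]
    set β := 16 * l ^ (-(ε / 2)) with hβ
    have hβ0 : 0 ≤ β := by positivity
    calc _ ≤ bitProb (fun ω : Sym2 (Fin n) → Bool =>
          S.card + 1 < (bitGraph ω).cliqueChromaticNumber) := by
          refine bitProb_mono fun ω hω => ?_
          have := not_le.1 hω
          rw [hS]
          have h8 : (k : ℝ) + 1 < (bitGraph ω).cliqueChromaticNumber := by linarith
          exact_mod_cast h8
      _ ≤ ∑ s ∈ Finset.Icc 2 n, (β ^ s + Real.exp (-(l ^ (1 + ε) / 4))) := by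
          refine (bitProb_card_add_one_lt_cliqueChromaticNumber_le S).trans ?_
          rw [Fintype.card_fin, hS]
          refine Finset.sum_le_sum fun s hs => ?_
          exact expected_maximal_cliques_le hε hl h1 (by have := (Finset.mem_Icc.1 hs).1; omega)
            hkk hkn h2 h3 h4
      _ ≤ _ := by
          rw [Finset.sum_add_distrib, Finset.sum_const, nsmul_eq_mul]
          refine add_le_add ?_ ?_
          · have hsum : Summable fun s : ℕ => β ^ (s + 1) :=
              ((summable_geometric_of_lt_one hβ0 (by linarith)).mul_left β).congr
                fun s => (pow_succ' β s).symm
            calc ∑ s ∈ Finset.Icc 2 n, β ^ s ≤ ∑ s ∈ Finset.Ico 1 (n + 1), β ^ s :=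
                  Finset.sum_le_sum_of_subset_of_nonneg (fun s hs => by
                    simp only [Finset.mem_Icc, Finset.mem_Ico] at hs ⊢; omega)
                    fun _ _ _ => by positivity
              _ = ∑ s ∈ Finset.range n, β * β ^ s := by
                  rw [Finset.sum_Ico_eq_sum_range]
                  exact Finset.sum_congr rfl fun s _ => by rw [add_comm, pow_succ']
              _ ≤ β * (1 - β)⁻¹ := by
                  rw [← Finset.mul_sum, ← tsum_geometric_of_lt_one hβ0 (by linarith)]
                  gcongr
                  exact (summable_geometric_of_lt_one hβ0 (by linarith)).sum_le_tsum _
                    fun _ _ => by positivity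
              _ ≤ β * 2 := by
                  gcongr
                  rw [inv_le_comm₀ (by linarith) (by norm_num)]; linarith
              _ = 2 * β := mul_comm _ _
          · rw [sub_eq_add_neg, Real.exp_add, Real.exp_log hn0]
            gcongr
            simp
  have hlim : Tendsto (fun l : ℝ => 2 * (16 * l ^ (-(ε / 2))) +
      Real.exp (l - l ^ (1 + ε) / 4)) atTop (𝓝 0) := by
    have h1 := ((tendsto_rpow_neg_atTop (by linarith : 0 < ε / 2)).const_mul 16).const_mul 2
    have h2 : Tendsto (fun l : ℝ => l ^ (1 + ε) / 4 - l) atTop atTop := by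
      have h3 := (tendsto_rpow_atTop hε).atTop_mul_const (by norm_num : (0 : ℝ) < 1 / 4)
      have h4 := (tendsto_atTop_add_const_right atTop (-1) h3).atTop_mul_atTop₀ tendsto_id
      refine h4.congr' ?_
      filter_upwards [eventually_gt_atTop 0] with l hl
      rw [Real.rpow_add hl, Real.rpow_one, id]; ring
    have h5 := Real.tendsto_exp_neg_atTop_nhds_zero.comp h2
    simpa [Function.comp_def] using h1.add h5
  exact squeeze_zero' (Eventually.of_forall fun n => bitProb_nonneg _) hbound
    (hlim.comp tendsto_log_nat)

/-! ### Parameters and asymptotics of the lower bound -/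

theorem choose_le_exp {n ℓ : ℕ} (hn : n ≤ 2 ^ ℓ) (m : ℕ) :
    (n.choose m : ℝ) ≤ Real.exp (ℓ * m) := by
  have h1 : (n.choose m : ℝ) ≤ (2 ^ ℓ) ^ m := by
    exact_mod_cast (Nat.choose_le_pow n m).trans (Nat.pow_le_pow_left hn m)
  refine h1.trans ?_
  rw [← pow_mul, show (ℓ * m : ℝ) = ((ℓ * m : ℕ) : ℝ) * 1 by push_cast; ring, Real.exp_nat_mul]
  gcongr
  linarith [Real.add_one_le_exp (1 : ℝ)]

/-- Since `q` is at least `e √(2 ^ ℓ)`, the base `e n / q` is at most `2 ^ (ℓ / 2)`. The saved half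
of the exponent makes the choice `t ≈ 2ℓ / 3` possible. -/
theorem choose_le_two_rpow {n ℓ q : ℕ} (hn : n ≤ 2 ^ ℓ) (hq0 : 0 < q)
    (hq : 3 * (2 : ℝ) ^ (ℓ / 2 : ℝ) ≤ q) :
    (n.choose q : ℝ) ≤ (2 : ℝ) ^ (ℓ / 2 * q : ℝ) := by
  have hq' : (0 : ℝ) < q := by exact_mod_cast hq0
  have hn' : (n : ℝ) ≤ (2 : ℝ) ^ (ℓ / 2 : ℝ) * (2 : ℝ) ^ (ℓ / 2 : ℝ) := by
    rw [← Real.rpow_add (by norm_num), add_halves, Real.rpow_natCast]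
    exact_mod_cast hn
  have he : Real.exp 1 ≤ 3 := by linarith [Real.exp_one_lt_d9]
  have hbase : (n : ℝ) * (Real.exp 1 / q) ≤ (2 : ℝ) ^ (ℓ / 2 : ℝ) := by
    rw [← mul_div_assoc, div_le_iff₀ hq']
    have : (0 : ℝ) < (2 : ℝ) ^ (ℓ / 2 : ℝ) := by positivity
    calc (n : ℝ) * Real.exp 1 ≤ ((2 : ℝ) ^ (ℓ / 2 : ℝ) * (2 : ℝ) ^ (ℓ / 2 : ℝ)) * 3 := by gcongr
      _ = (2 : ℝ) ^ (ℓ / 2 : ℝ) * (3 * (2 : ℝ) ^ (ℓ / 2 : ℝ)) := by ring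
      _ ≤ _ := by gcongr
  calc (n.choose q : ℝ) ≤ n ^ q * (1 / q.factorial) := by
        rw [mul_one_div]; exact choose_le_pow_div_factorial n q
    _ ≤ n ^ q * (Real.exp 1 / q) ^ q := by gcongr; exact inv_factorial_le q hq0
    _ = (n * (Real.exp 1 / q)) ^ q := by rw [mul_pow]
    _ ≤ ((2 : ℝ) ^ (ℓ / 2 : ℝ)) ^ q := by gcongr
    _ = _ := by rw [← Real.rpow_natCast, ← Real.rpow_mul (by norm_num)]

/-- With `N = K * (s * p)`, the mean `n 2 ^ (-K)` is at least `8N`, so the moment factor is about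
`exp (-4N)` and absorbs both `2 ^ N` and the choice of the `K` vertices. -/
theorem common_nonneighbors_bound {n ℓ s p K : ℕ} (hn : n ≤ 2 ^ ℓ) (hs : s = ℓ + 6)
    (hp : 200 * s ^ 5 ≤ p) (hK0 : 0 < K) (hK : 8 * (K * (s * p)) * 2 ^ K ≤ n) :
    (n.choose K : ℝ) * (2 ^ (K * (s * p)) * (1 - (1 / 2) ^ K / 2) ^ (n - K)) ≤
      Real.exp (-s) := by
  have hs6 : 6 ≤ s := by omega
  have hKl : K ≤ ℓ := by
    have h1 : 2 ^ K ≤ 2 ^ ℓ := by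
      refine le_trans ?_ (hK.trans hn)
      have : 0 < 8 * (K * (s * p)) := by
        have : 0 < p := lt_of_lt_of_le (by positivity) hp
        positivity
      nlinarith [pow_pos (by norm_num : 0 < 2) K]
    exact (Nat.pow_le_pow_iff_right (by norm_num)).1 h1
  set N := K * (s * p) with hN
  have hpN : p ≤ N := by
    rw [hN]; nlinarith [Nat.zero_le p, Nat.mul_le_mul hK0 (by omega : 1 ≤ s)]
  have hKn : K ≤ n := by
    refine le_trans ?_ hK
    have : K < 2 ^ K := Nat.lt_two_pow_self
    have : 1 ≤ 8 * N := by
      have : 1 ≤ p := le_trans (Nat.one_le_iff_ne_zero.2 (by positivity)) hp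
      omega
    nlinarith
  set z : ℝ := n * (1 / 2) ^ K with hz
  have h2K : (0 : ℝ) < 2 ^ K := by positivity
  have hzN : 8 * (N : ℝ) ≤ z := by
    rw [hz, one_div, inv_pow, ← div_eq_mul_inv, le_div_iff₀ h2K]
    exact_mod_cast hK
  have h1 : (1 - (1 / 2 : ℝ) ^ K / 2) ^ (n - K) ≤ Real.exp (-(z / 2) + 1 / 2) := by
    refine (one_sub_pow_le_exp ?_ _).trans (Real.exp_le_exp.2 ?_)
    · linarith [pow_le_one₀ (n := K) (by norm_num : (0 : ℝ) ≤ 1 / 2) (by norm_num)]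
    · rw [Nat.cast_sub hKn]
      have : (K : ℝ) * (1 / 2) ^ K ≤ 1 := by
        rw [one_div, inv_pow, ← div_eq_mul_inv, div_le_one h2K]
        exact_mod_cast Nat.lt_two_pow_self.le
      rw [hz]; linarith
  have h2 : (2 : ℝ) ^ N ≤ Real.exp N := by
    rw [show (N : ℝ) = (N : ℝ) * 1 by ring, Real.exp_nat_mul]
    gcongr
    linarith [Real.add_one_le_exp (1 : ℝ)]
  have h3 : (n.choose K : ℝ) ≤ Real.exp ((s : ℝ) * s) := by
    refine (choose_le_exp hn K).trans (Real.exp_le_exp.2 ?_)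
    gcongr
    · omega
    · omega
  have h4 : (0 : ℝ) ≤ 1 - (1 / 2) ^ K / 2 := by
    linarith [pow_le_one₀ (n := K) (by norm_num : (0 : ℝ) ≤ 1 / 2) (by norm_num)]
  calc _ ≤ Real.exp ((s : ℝ) * s) * (Real.exp N * Real.exp (-(z / 2) + 1 / 2)) := by gcongr
    _ = Real.exp ((s : ℝ) * s + (N + (-(z / 2) + 1 / 2))) := by
      rw [Real.exp_add (s * s : ℝ), Real.exp_add (N : ℝ)]
    _ ≤ _ := by
      rw [Real.exp_le_exp]
      have hsR : (6 : ℝ) ≤ s := by exact_mod_cast hs6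
      have hpR : 200 * (s : ℝ) ^ 5 ≤ p := by exact_mod_cast hp
      have hpN' : (p : ℝ) ≤ N := by exact_mod_cast hpN
      have h5 : (s : ℝ) ^ 2 ≤ s ^ 5 := pow_le_pow_right₀ (by linarith) (by norm_num)
      nlinarith

/-- Choosing the `q = r * p` vertices costs `2 ^ (ℓ q / 2)`, while `t + 1 ≥ 2ℓ / 3` gains `2 ^ (8 ℓ
q / 15)`. The surplus `ℓ q / 30` pays for the choice of the `t + 1` vertices because `q ≥ 200 s`. -/
theorem almost_dominating_bound {n ℓ s p r t : ℕ} (hn : n ≤ 2 ^ ℓ) (hℓ : 1 ≤ ℓ) (hs : s = ℓ + 6)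
    (hp : 200 * s ^ 5 ≤ p) (hp2 : 3 * (2 : ℝ) ^ (ℓ / 2 : ℝ) ≤ p) (hr : 1 ≤ r) (ht : 2 * ℓ ≤ 3 * (t + 1))
    (hts : t + 1 ≤ s) :
    (n.choose (r * p) : ℝ) * n.choose (t + 1) *
      (2 : ℝ) ^ (-(4 / 5 * (r * p : ℕ) * (t + 1 : ℕ) : ℝ)) ≤ Real.exp (-s) := by
  have hs6 : 6 ≤ s := by omega
  have hp0 : 0 < p := lt_of_lt_of_le (by positivity) hp
  set q := r * p with hq
  have hpq : p ≤ q := by rw [hq]; nlinarith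
  have hpqR : (p : ℝ) ≤ q := by exact_mod_cast hpq
  have h1 := choose_le_two_rpow (q := q) hn (by positivity) (hp2.trans hpqR)
  have h2 : (n.choose (t + 1) : ℝ) ≤ (2 : ℝ) ^ (ℓ * s : ℝ) := by
    have : (n.choose (t + 1)) ≤ 2 ^ (ℓ * s) := by
      refine (Nat.choose_le_pow n _).trans ((Nat.pow_le_pow_left hn _).trans ?_)
      rw [← pow_mul]
      exact Nat.pow_le_pow_right (by norm_num) (Nat.mul_le_mul_left _ hts)
    have e : (2 : ℝ) ^ (ℓ * s : ℝ) = ((2 ^ (ℓ * s) : ℕ) : ℝ) := by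
      push_cast; rw [← Real.rpow_natCast]; push_cast; rfl
    rw [e]; exact_mod_cast this
  have h3 : (2 : ℝ) ^ (-(2 * s) : ℝ) ≤ Real.exp (-s) := by
    rw [Real.rpow_def_of_pos (by norm_num), Real.exp_le_exp]
    have := Real.log_two_gt_d9
    have : (0 : ℝ) ≤ s := by positivity
    nlinarith
  refine le_trans ?_ h3
  calc _ ≤ (2 : ℝ) ^ (ℓ / 2 * q : ℝ) * (2 : ℝ) ^ (ℓ * s : ℝ) *
        (2 : ℝ) ^ (-(4 / 5 * q * (t + 1 : ℕ)) : ℝ) := by gcongr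
    _ = (2 : ℝ) ^ (ℓ / 2 * q + ℓ * s + -(4 / 5 * q * (t + 1 : ℕ)) : ℝ) := by
      rw [Real.rpow_add (by norm_num), Real.rpow_add (by norm_num)]
    _ ≤ _ := by
      apply Real.rpow_le_rpow_of_exponent_le (by norm_num)
      have hsR : (6 : ℝ) ≤ s := by exact_mod_cast hs6
      have hpR : 200 * (s : ℝ) ^ 5 ≤ p := by exact_mod_cast hp
      have hlR : (1 : ℝ) ≤ ℓ := by exact_mod_cast hℓ
      have htR : 2 * (ℓ : ℝ) ≤ 3 * (t + 1 : ℕ) := by exact_mod_cast ht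
      have h5 : (s : ℝ) ≤ s ^ 5 := by
        conv_lhs => rw [← pow_one (s : ℝ)]
        exact pow_le_pow_right₀ (by linarith) (by norm_num)
      have h6 : 200 * (s : ℝ) ≤ q := by linarith
      have h7 : 4 / 5 * (q : ℝ) * (2 / 3 * ℓ) ≤ 4 / 5 * q * (t + 1 : ℕ) := by gcongr; linarith
      nlinarith [mul_le_mul_of_nonneg_left h6 (by linarith : (0 : ℝ) ≤ ℓ)]

/-- With deviation `1 / s` and `s³` exceptional vertices, the gain `exp (-2 s p)` beats the cost
`exp (ℓ p)` of choosing the part. -/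
theorem large_degree_bound {n ℓ s p : ℕ} (hn : n ≤ 2 ^ ℓ) (hs : s = ℓ + 6)
    (hp : 200 * s ^ 5 ≤ p) :
    (n.choose p : ℝ) * n.choose (s ^ 3 + 1) *
      Real.exp (-(2 * (1 / s : ℝ) ^ 2 * p * (s ^ 3 + 1 : ℕ))) ≤ Real.exp (-s) := by
  have hs6 : 6 ≤ s := by omega
  have hsR : (6 : ℝ) ≤ s := by exact_mod_cast hs6
  have hpR : 200 * (s : ℝ) ^ 5 ≤ p := by exact_mod_cast hp
  have hls : (ℓ : ℝ) ≤ s := by exact_mod_cast (by omega : ℓ ≤ s)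
  calc _ ≤ Real.exp (ℓ * p) * Real.exp (ℓ * (s ^ 3 + 1 : ℕ)) * Real.exp (-(2 * s * p)) := by
        gcongr ?_ * ?_ * ?_
        · exact choose_le_exp hn _
        · exact choose_le_exp hn _
        · have : (2 * s * p : ℝ) = 2 * (1 / s) ^ 2 * p * s ^ 3 := by field_simp
          rw [this, Real.exp_le_exp, neg_le_neg_iff]
          refine mul_le_mul_of_nonneg_left ?_ (by positivity)
          push_cast; linarith
    _ = Real.exp (ℓ * p + ℓ * (s ^ 3 + 1 : ℕ) + -(2 * s * p)) := by
        rw [Real.exp_add, Real.exp_add]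
    _ ≤ _ := by
        rw [Real.exp_le_exp]
        push_cast
        have hp0 : (0 : ℝ) ≤ p := by positivity
        have h1 : (ℓ : ℝ) * p ≤ s * p := by gcongr
        have h2 : (ℓ : ℝ) * (s ^ 3 + 1) ≤ s * (s ^ 3 + 1) := by gcongr
        have h3 : (s : ℝ) ^ 3 ≤ s ^ 5 := pow_le_pow_right₀ (by linarith) (by norm_num)
        have h4 : 1 ≤ (s : ℝ) ^ 3 := one_le_pow₀ (by linarith)
        have h5 : s * (s ^ 3 + 2) ≤ (s : ℝ) * p := by gcongr; linarith
        linarith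

/-- The union bound over systems of parts costs at most `exp (ℓ s p)`; as `p ≥ 200 s⁵`, Janson's
exponent is at least `25 s² p`. -/
theorem transversal_bound {n ℓ s p : ℕ} (hn : n ≤ 2 ^ ℓ) (hs : s = ℓ + 6)
    (hp : 200 * s ^ 5 ≤ p) :
    (n : ℝ) ^ (s * p) * Real.exp (-(p : ℝ) ^ 2 / (8 * (s : ℝ) ^ 3)) ≤ Real.exp (-s) := by
  have hs6 : 6 ≤ s := by omega
  have hsR : (6 : ℝ) ≤ s := by exact_mod_cast hs6
  have hpR : 200 * (s : ℝ) ^ 5 ≤ p := by exact_mod_cast hp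
  have hls : (ℓ : ℝ) ≤ s := by exact_mod_cast (by omega : ℓ ≤ s)
  have h1 : (n : ℝ) ^ (s * p) ≤ Real.exp (ℓ * (s * p : ℕ)) := by
    have : (n : ℝ) ^ (s * p) ≤ (2 ^ ℓ) ^ (s * p) := by gcongr; exact_mod_cast hn
    refine this.trans ?_
    rw [← pow_mul, show (ℓ * (s * p : ℕ) : ℝ) = ((ℓ * (s * p) : ℕ) : ℝ) * 1 by push_cast; ring,
      Real.exp_nat_mul]
    gcongr
    linarith [Real.add_one_le_exp (1 : ℝ)]
  refine (mul_le_mul_of_nonneg_right h1 (Real.exp_pos _).le).trans ?_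
  rw [← Real.exp_add, Real.exp_le_exp]
  push_cast
  have hs0 : (0 : ℝ) < s := by linarith
  have hp0 : (0 : ℝ) ≤ p := by positivity
  have h2 : (25 * s ^ 2 : ℝ) * p ≤ p ^ 2 / (8 * s ^ 3) := by
    rw [le_div_iff₀ (by positivity)]
    nlinarith
  have h3 : (ℓ : ℝ) * (s * p) ≤ s * (s * p) := by gcongr
  have h5 : (1 : ℝ) ≤ s ^ 5 := one_le_pow₀ (by linarith)
  have h6 : (s : ℝ) * 1 ≤ s ^ 2 * p := by
    have : (1 : ℝ) ≤ p := by linarith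
    gcongr
    nlinarith
  rw [neg_div]
  nlinarith

/-- The offset `6` in `s = ℓ + 6` is for this: `(1 + 2 / s) ^ s ≤ e² ≤ 8`, while `n 2 ^ (-s) ≤ 1 /
64`. -/
theorem half_add_inv_pow_le {n ℓ s r T : ℕ} (hn : n ≤ 2 ^ ℓ) (hs : s = ℓ + 6) (hr : s ≤ 3 * r)
    (hT : T = s ^ 3) (hexp : (s : ℝ) ^ 4 * Real.exp (-(s / 120 : ℝ)) ≤ 1 / 4) :
    (n : ℝ) * (1 / 2 + 1 / s) ^ s + s * T * Real.exp (-(r / 40 : ℝ)) ≤ 1 / 2 := by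
  have hsR : (6 : ℝ) ≤ s := by exact_mod_cast (by omega : 6 ≤ s)
  have h1 : (n : ℝ) * (1 / 2 + 1 / s) ^ s ≤ 1 / 4 := by
    have e : (1 / 2 + 1 / s : ℝ) = (1 / 2) * (2 / s + 1) := by ring
    have h2 : (2 / s + 1 : ℝ) ^ s ≤ Real.exp 2 := by
      calc (2 / s + 1 : ℝ) ^ s ≤ Real.exp (2 / s) ^ s := by
            gcongr; exact Real.add_one_le_exp _
        _ = Real.exp 2 := by rw [← Real.exp_nat_mul]; congr 1; field_simp
    have h3 : Real.exp 2 ≤ 8 := by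
      have := Real.exp_one_lt_d9
      rw [show (2 : ℝ) = 1 + 1 by norm_num, Real.exp_add]
      nlinarith [Real.exp_pos 1]
    have h4 : (n : ℝ) ≤ 2 ^ ℓ := by exact_mod_cast hn
    calc (n : ℝ) * (1 / 2 + 1 / s) ^ s ≤ 2 ^ ℓ * ((1 / 2) ^ s * 8) := by
          rw [e, mul_pow]; gcongr; exact h2.trans h3
      _ = 1 / 8 := by
          rw [hs, pow_add (1 / 2 : ℝ), ← mul_assoc, ← mul_assoc, ← mul_pow]; norm_num
      _ ≤ _ := by norm_num
  have h2 : (s : ℝ) * T * Real.exp (-(r / 40 : ℝ)) ≤ 1 / 4 := by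
    refine le_trans ?_ hexp
    have hr' : (s : ℝ) ≤ 3 * r := by exact_mod_cast hr
    have e : (s : ℝ) * T = s ^ 4 := by rw [hT]; push_cast; ring
    rw [e]
    exact mul_le_mul_of_nonneg_left (Real.exp_le_exp.2 (by linarith)) (by positivity)
  linarith

open Classical in
/-- A random graph is unlikely to have a clique colouring with few colours. -/
theorem bitProb_exists_isCliqueColoring_le {V : Type*} [Fintype V] [DecidableEq V] {ℓ s p K : ℕ}
    (hn : Fintype.card V ≤ 2 ^ ℓ) (hℓ : 1 ≤ ℓ) (hs : s = ℓ + 6) (hp : p = s * 2 ^ (s / 2 + 2))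
    (hp5 : 200 * s ^ 5 ≤ p) (hexp : (s : ℝ) ^ 4 * Real.exp (-(s / 120 : ℝ)) ≤ 1 / 4)
    (hK0 : 0 < K) (hK : 8 * (K * (s * p)) * 2 ^ K ≤ Fintype.card V) :
    bitProb (fun ω : Sym2 V → Bool => ∃ c : V → Fin K, (bitGraph ω).IsCliqueColoring c) ≤
      4 * Real.exp (-s) := by
  -- The extra parts must outnumber the almost dominating vertices (`t + 1 ≥ 2ℓ / 3`), while `r ≥ s
  -- / 3` parts remain to make `exp (-r / 40)` beat `s⁴`.
  obtain ⟨t, ht⟩ : ∃ t, t = 2 * ℓ / 3 := ⟨_, rfl⟩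
  obtain ⟨r, hr⟩ : ∃ r, r = s - t := ⟨_, rfl⟩
  have hrt : r + t = s := by omega
  have hp0 : 0 < p := by rw [hp, hs]; positivity
  have hKV : K ≤ Fintype.card V := by
    refine le_trans ?_ hK
    have h1 : K < 2 ^ K := Nat.lt_two_pow_self
    have h2 : 1 ≤ 8 * (K * (s * p)) := Nat.one_le_iff_ne_zero.2 (by rw [hs]; positivity)
    nlinarith
  have hpp : s ^ 2 * 2 ^ (s + 1) ≤ p ^ 2 := by
    rw [hp, mul_pow, ← pow_mul]
    gcongr
    · norm_num
    · omega
  have hp3 : 3 * (2 : ℝ) ^ (ℓ / 2 : ℝ) ≤ p := by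
    have h1 : (2 : ℝ) ^ ((ℓ / 2 : ℝ) + 2) ≤ (2 : ℝ) ^ ((s / 2 + 2 : ℕ) : ℝ) := by
      apply Real.rpow_le_rpow_of_exponent_le (by norm_num)
      have : ℓ + 4 ≤ 2 * (s / 2 + 2) := by omega
      have : (ℓ : ℝ) + 4 ≤ 2 * (s / 2 + 2 : ℕ) := by exact_mod_cast this
      linarith
    rw [Real.rpow_add (by norm_num), Real.rpow_natCast] at h1
    have h2 : (2 : ℝ) ^ (s / 2 + 2) ≤ p := by
      have : 2 ^ (s / 2 + 2) ≤ p := by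
        rw [hp]; exact Nat.le_mul_of_pos_left _ (by omega)
      exact_mod_cast this
    have h3 : (0 : ℝ) < (2 : ℝ) ^ (ℓ / 2 : ℝ) := by positivity
    norm_num at h1
    linarith
  have hcardι : Fintype.card (Fin r ⊕ Fin t) = s := by simp [hrt]
  set X : Finset ((Fin r ⊕ Fin t) × Fin p → V) := Finset.univ.filter Function.Injective with hX
  set E₁ : (Sym2 V → Bool) → Prop := fun ω => ∃ S : Finset V, S.card = K ∧
      (Finset.univ.filter fun w => w ∉ S ∧ ∀ v ∈ S, ¬ (bitGraph ω).Adj w v).card < K * (s * p)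
  set E₂ : (Sym2 V → Bool) → Prop := fun ω => ∃ Q : Finset V, Q.card = r * p ∧
      t + 1 ≤ (Finset.univ.filter fun v => v ∉ Q ∧
        40 * (Q.filter fun u => ¬ (bitGraph ω).Adj v u).card ≤ r * p).card
  set E₃ : (Sym2 V → Bool) → Prop := fun ω => ∃ P : Finset V, P.card = p ∧
      s ^ 3 + 1 ≤ (Finset.univ.filter fun v => v ∉ P ∧
        (1 / 2 + 1 / (s : ℝ)) * p < (P.filter fun u => (bitGraph ω).Adj v u).card).card
  set E₄ : (Sym2 V → Bool) → Prop := fun ω => ∃ x ∈ X,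
      2 * ∑ v with v ∉ Set.range x, ∏ i, (Finset.univ.filter fun a =>
        (bitGraph ω).Adj v (x (i, a))).card ≤ p ^ Fintype.card (Fin r ⊕ Fin t) ∧
      ¬ ∃ y : Fin r ⊕ Fin t → Fin p, (bitGraph ω).IsClique (transversal x y) ∧
        ∀ v, v ∉ Set.range x → ∃ i, ¬ (bitGraph ω).Adj v (x (i, y i))
  have b1 : bitProb E₁ ≤ Real.exp (-s) :=
    (bitProb_few_common_nonneighbors_le K _).trans (common_nonneighbors_bound hn hs hp5 hK0 hK)
  have b2 : bitProb E₂ ≤ Real.exp (-s) :=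
    (bitProb_many_almost_dominating_le (r * p) (t + 1)).trans
      (almost_dominating_bound hn hℓ hs hp5 hp3 (by omega) (by omega) (by omega))
  have b3 : bitProb E₃ ≤ Real.exp (-s) :=
    (bitProb_many_large_degree_le p (s ^ 3 + 1) (1 / (s : ℝ)) (by positivity)).trans
      (large_degree_bound hn hs hp5)
  have b4 : bitProb E₄ ≤ Real.exp (-s) := by
    refine (bitProb_exists_le X _).trans ?_
    refine (Finset.sum_le_sum fun x hx => bitProb_no_undominated_clique_le
      (Finset.mem_filter.1 hx).2 (by rwa [hcardι]) (by omega)).trans ?_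
    rw [Finset.sum_const, nsmul_eq_mul, hcardι]
    refine le_trans ?_ (transversal_bound hn hs hp5)
    gcongr
    have : X.card ≤ Fintype.card V ^ (s * p) := by
      refine (Finset.card_le_univ X).trans (le_of_eq ?_)
      simp [hrt]
    exact_mod_cast this
  calc _ ≤ bitProb (fun ω => (E₁ ω ∨ E₂ ω) ∨ (E₃ ω ∨ E₄ ω)) := by
        refine bitProb_mono fun ω ⟨c, hc⟩ => ?_
        by_contra hcon
        push Not at hcon
        obtain ⟨⟨h1, h2⟩, h3, h4⟩ := hcon
        refine not_isCliqueColoring_of_pseudorandom (bitGraph ω) (1 / (s : ℝ)) (s ^ 3) K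
          (by positivity) hp0 (by omega : 2 ≤ r + t) hK0 hKV ?_ ?_ ?_ ?_ ?_ c hc
        · intro S hS
          rw [hrt]
          exact not_lt.1 fun h => h1 ⟨S, hS, h⟩
        · intro Q hQ
          exact Nat.lt_succ_iff.1 (not_le.1 fun h => h2 ⟨Q, hQ, h⟩)
        · intro P hP
          exact Nat.lt_succ_iff.1 (not_le.1 fun h => h3 ⟨P, hP, h⟩)
        · intro x hx hsum
          by_contra hy
          exact h4 ⟨x, Finset.mem_filter.2 ⟨Finset.mem_univ _, hx⟩, hsum, hy⟩
        · have e : (r : ℝ) + t = s := by exact_mod_cast hrt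
          rw [hrt, e]
          exact half_add_inv_pow_le hn hs (by omega) rfl hexp
    _ ≤ (bitProb E₁ + bitProb E₂) + (bitProb E₃ + bitProb E₄) :=
        (bitProb_or_le _ _).trans (add_le_add (bitProb_or_le _ _) (bitProb_or_le _ _))
    _ ≤ _ := by linarith

theorem eventually_two_hundred_mul_pow_le :
    ∀ᶠ s : ℕ in atTop, 200 * s ^ 5 ≤ s * 2 ^ (s / 2 + 2) := by
  have h1 : ∀ᶠ m : ℕ in atTop, 200 * (3 * m) ^ 5 ≤ 2 ^ m := by
    have h2 := (tendsto_pow_const_div_const_pow_of_one_lt 5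
      (by norm_num : (1 : ℝ) < 2)).eventually_le_const (by norm_num : (0 : ℝ) < 1 / (200 * 3 ^ 5))
    filter_upwards [h2] with m hm
    rw [div_le_div_iff₀ (by positivity) (by positivity)] at hm
    have : (200 * (3 * m) ^ 5 : ℝ) ≤ 2 ^ m := by rw [mul_pow]; linarith
    exact_mod_cast this
  have h3 : Tendsto (fun s : ℕ => s / 2) atTop atTop :=
    Nat.tendsto_div_const_atTop (by norm_num)
  filter_upwards [h3.eventually h1, eventually_ge_atTop 2] with s hs hs2
  calc 200 * s ^ 5 ≤ 200 * (3 * (s / 2)) ^ 5 := by gcongr; omega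
    _ ≤ 2 ^ (s / 2) := hs
    _ ≤ 2 ^ (s / 2 + 2) := Nat.pow_le_pow_right (by norm_num) (by omega)
    _ ≤ _ := Nat.le_mul_of_pos_left _ (by omega)

theorem eventually_pow_mul_exp_le :
    ∀ᶠ s : ℕ in atTop, (s : ℝ) ^ 4 * Real.exp (-(s / 120 : ℝ)) ≤ 1 / 4 := by
  have h1 := (Real.tendsto_pow_mul_exp_neg_atTop_nhds_zero 4).comp
    (tendsto_natCast_atTop_atTop (R := ℝ) |>.atTop_div_const (by norm_num : (0 : ℝ) < 120))
  filter_upwards [h1.eventually_le_const (by norm_num : (0 : ℝ) < 1 / (4 * 120 ^ 4))] with s hs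
  simp only [Function.comp_apply, div_pow] at hs
  have e : (s : ℝ) ^ 4 * Real.exp (-(s / 120 : ℝ)) =
      120 ^ 4 * ((s : ℝ) ^ 4 / 120 ^ 4 * Real.exp (-(s / 120 : ℝ))) := by ring
  rw [e]
  linarith

theorem log_le_clog (n : ℕ) (hn : 1 ≤ n) : Real.log n ≤ Nat.clog 2 n := by
  have h1 : (n : ℝ) ≤ 2 ^ Nat.clog 2 n := by exact_mod_cast Nat.le_pow_clog (by norm_num) n
  have h2 := Real.log_le_log (by exact_mod_cast hn) h1
  rw [Real.log_pow] at h2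
  have h3 := Real.log_two_lt_d9
  nlinarith [(Nat.cast_nonneg (Nat.clog 2 n) : (0 : ℝ) ≤ _)]

theorem two_pow_clog_le (n : ℕ) (hn : 2 ≤ n) : (2 : ℝ) ^ Nat.clog 2 n ≤ 2 * n := by
  have h1 := Nat.pow_pred_clog_lt_self (by norm_num : 1 < 2) (by omega : 1 < n)
  obtain ⟨m, hm⟩ : ∃ m, Nat.clog 2 n = m + 1 :=
    Nat.exists_eq_add_of_le' (Nat.clog_pos (by norm_num) hn)
  rw [hm] at h1 ⊢
  have h2 : (2 : ℝ) ^ m ≤ n := by exact_mod_cast h1.le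
  rw [pow_succ]; linarith

theorem clog_le_log (n : ℕ) (hn : 2 ≤ n) :
    (Nat.clog 2 n : ℝ) ≤ 3 / 2 * Real.log n + 3 / 2 := by
  have h2 := Real.log_le_log (by positivity) (two_pow_clog_le n hn)
  rw [Real.log_pow, Real.log_mul (by norm_num) (by positivity)] at h2
  have h3 := Real.log_two_gt_d9
  have h4 := Real.log_two_lt_d9
  nlinarith [(Nat.cast_nonneg (Nat.clog 2 n) : (0 : ℝ) ≤ _)]

/-- Squaring avoids `√n`. The factors `K`, `s` and the `s` in `p` give `l⁶`, matched by the constant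
`3`; the numerical factor `2 ^ 21` is absorbed by `l ^ (2ε)`. -/
theorem eight_mul_two_pow_le {n s p K : ℕ} {ε l : ℝ} (hn : 2 ≤ n) (hl : 21 ≤ l)
    (hlε : 2 ^ 21 ≤ l ^ (2 * ε)) (hs : s = Nat.clog 2 n + 6) (hsl : (s : ℝ) ≤ 2 * l)
    (hp : p = s * 2 ^ (s / 2 + 2)) (hKl : (K : ℝ) ≤ l)
    (hK : (K : ℝ) ≤ 1 / 2 * Real.logb 2 n - (3 + ε) * Real.logb 2 l) :
    8 * (K * (s * p)) * 2 ^ K ≤ n := by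
  have hl0 : 0 < l := by linarith
  have hn0 : (0 : ℝ) < n := by positivity
  have hp2 : (p : ℝ) ^ 2 ≤ 2048 * s ^ 2 * n := by
    have h1 : p ^ 2 ≤ s ^ 2 * (16 * 2 ^ s) := by
      rw [hp, mul_pow, ← pow_mul, show 16 * 2 ^ s = 2 ^ (s + 4) by rw [pow_add]; ring]
      gcongr
      · norm_num
      · omega
    have h2 : (p : ℝ) ^ 2 ≤ s ^ 2 * (16 * 2 ^ s) := by exact_mod_cast h1
    have h3 : (2 : ℝ) ^ s ≤ 128 * n := by
      rw [hs, pow_add]; linarith [two_pow_clog_le n hn]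
    calc (p : ℝ) ^ 2 ≤ s ^ 2 * (16 * 2 ^ s) := h2
      _ ≤ s ^ 2 * (16 * (128 * n)) := by gcongr
      _ = _ := by ring
  have h2K : ((2 : ℝ) ^ K) ^ 2 * (l ^ 6 * l ^ (2 * ε)) ≤ n := by
    have h1 : ((2 : ℝ) ^ K) ^ 2 = (2 : ℝ) ^ (2 * K : ℝ) := by
      rw [← pow_mul, ← Real.rpow_natCast]; push_cast; rw [mul_comm]
    have h2 : l ^ 6 * l ^ (2 * ε) = (2 : ℝ) ^ (2 * (3 + ε) * Real.logb 2 l) := by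
      rw [mul_comm (2 * (3 + ε)), Real.rpow_mul (x := 2) (by norm_num),
        Real.rpow_logb (by norm_num) (by norm_num) hl0, ← Real.rpow_natCast, ← Real.rpow_add hl0]
      congr 1; push_cast; ring
    rw [h1, h2, ← Real.rpow_add (by norm_num)]
    calc _ ≤ (2 : ℝ) ^ Real.logb 2 n :=
          Real.rpow_le_rpow_of_exponent_le (by norm_num) (by linarith)
      _ = n := Real.rpow_logb (by norm_num) (by norm_num) hn0
  have key : (8 * (K * (s * p)) * 2 ^ K : ℝ) ^ 2 ≤ (n : ℝ) ^ 2 := by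
    calc (8 * (K * (s * p)) * 2 ^ K : ℝ) ^ 2
        = 64 * (K : ℝ) ^ 2 * (s : ℝ) ^ 2 * (p : ℝ) ^ 2 * ((2 : ℝ) ^ K) ^ 2 := by ring
      _ ≤ 64 * l ^ 2 * (2 * l) ^ 2 * (2048 * (2 * l) ^ 2 * n) * ((2 : ℝ) ^ K) ^ 2 := by
          gcongr
          exact hp2.trans (by gcongr)
      _ = n * (((2 : ℝ) ^ K) ^ 2 * (l ^ 6 * 2 ^ 21)) := by ring
      _ ≤ n * (((2 : ℝ) ^ K) ^ 2 * (l ^ 6 * l ^ (2 * ε))) := by gcongr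
      _ ≤ n * n := by gcongr
      _ = _ := by ring
  have := (sq_le_sq₀ (by positivity) hn0.le).1 key
  exact_mod_cast this

theorem SimpleGraph.IsCliqueColoring.comp_injective {V κ κ' : Type*} {G : SimpleGraph V}
    {c : V → κ} (h : G.IsCliqueColoring c) {f : κ → κ'} (hf : Function.Injective f) :
    G.IsCliqueColoring (f ∘ c) := by
  rintro M hM hM2 ⟨a, ha⟩
  obtain ⟨v, hv⟩ := hM2.nonempty
  exact h M hM hM2 ⟨c v, fun w hw => hf ((ha w hw).trans (ha v hv).symm)⟩

theorem logb_log_nonneg {l : ℝ} (hl : 1 ≤ l) : 0 ≤ Real.logb 2 l :=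
  Real.logb_nonneg (by norm_num) hl

theorem eventually_logb_log_le {c : ℝ} (hc : 0 < c) :
    ∀ᶠ n : ℕ in atTop, Real.logb 2 (Real.log n) ≤ c * Real.logb 2 n := by
  have h := (Real.isLittleO_log_id_atTop.bound hc)
  filter_upwards [tendsto_log_nat.eventually (h.and (eventually_ge_atTop 0))] with n ⟨h1, h2⟩
  simp only [id, Real.norm_eq_abs, abs_of_nonneg h2] at h1
  have h3 := (le_abs_self _).trans h1
  rw [Real.logb, Real.logb, ← mul_div_assoc]
  have := Real.log_pos (by norm_num : (1 : ℝ) < 2)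
  gcongr

/-- With high probability many colours are needed. -/
theorem tendsto_bitProb_lower {ε : ℝ} (hε : 0 < ε) :
    Tendsto (fun n : ℕ => bitProb fun ω : Sym2 (Fin n) → Bool =>
      ¬ (1 / 2 * Real.logb 2 n - (3 + ε) * Real.logb 2 (Real.log n) ≤
        ((bitGraph ω).cliqueChromaticNumber : ℝ))) atTop (𝓝 0) := by
  have hlim : Tendsto (fun n : ℕ => 4 * Real.exp (-Real.log n)) atTop (𝓝 0) := by
    simpa [Function.comp_def] using
      (Real.tendsto_exp_neg_atTop_nhds_zero.comp tendsto_log_nat).const_mul 4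
  refine squeeze_zero' (Eventually.of_forall fun n => bitProb_nonneg _) ?_ hlim
  have hsT : Tendsto (fun n : ℕ => Nat.clog 2 n + 6) atTop atTop := by
    refine tendsto_atTop_mono (fun n => Nat.le_add_right _ 6) ?_
    refine (tendsto_natCast_atTop_iff (R := ℝ)).1 (tendsto_atTop_mono' _ ?_ tendsto_log_nat)
    filter_upwards [eventually_ge_atTop 1] with n hn using log_le_clog n hn
  have hB1 : ∀ᶠ n : ℕ in atTop,
      1 ≤ 1 / 2 * Real.logb 2 n - (3 + ε) * Real.logb 2 (Real.log n) := by
    filter_upwards [eventually_logb_log_le (c := 1 / (4 * (3 + ε))) (by positivity),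
      tendsto_log_nat.eventually_ge_atTop 4] with n h1 h2
    have h3 : Real.log n ≤ Real.logb 2 n := by
      rw [Real.logb, le_div_iff₀ (Real.log_pos (by norm_num))]
      nlinarith [Real.log_two_lt_d9]
    have h4 : (3 + ε) * Real.logb 2 (Real.log n) ≤ (3 + ε) * (1 / (4 * (3 + ε)) * Real.logb 2 n) := by
      gcongr
    have h5 : (3 + ε) * (1 / (4 * (3 + ε)) * Real.logb 2 n) = 1 / 4 * Real.logb 2 n := by
      field_simp
    linarith
  have hlε : ∀ᶠ n : ℕ in atTop, 2 ^ 21 ≤ (Real.log n) ^ (2 * ε) :=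
    ((tendsto_rpow_atTop (by positivity : 0 < 2 * ε)).comp tendsto_log_nat).eventually_ge_atTop _
  filter_upwards [eventually_ge_atTop 2, tendsto_log_nat.eventually_ge_atTop 21, hB1, hlε,
    hsT.eventually eventually_two_hundred_mul_pow_le, hsT.eventually eventually_pow_mul_exp_le]
    with n hn hl hB1 hlε h5 hexp
  obtain ⟨s, hs⟩ : ∃ s, s = Nat.clog 2 n + 6 := ⟨_, rfl⟩
  rw [← hs] at h5 hexp
  set l := Real.log n with hldef
  set B := 1 / 2 * Real.logb 2 n - (3 + ε) * Real.logb 2 l with hB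
  have hKB : (⌊B⌋₊ : ℝ) ≤ B := Nat.floor_le (by linarith)
  have hBl : B ≤ l := by
    have h1 : Real.logb 2 n ≤ 2 * l := by
      rw [Real.logb, div_le_iff₀ (Real.log_pos (by norm_num))]
      nlinarith [Real.log_two_gt_d9]
    have h2 := logb_log_nonneg (by linarith : 1 ≤ l)
    have h3 : 0 ≤ (3 + ε) * Real.logb 2 l := by positivity
    linarith
  have hsl : (s : ℝ) ≤ 2 * l := by
    rw [hs]; push_cast; linarith [clog_le_log n hn]
  have hK := eight_mul_two_pow_le hn hl hlε hs hsl rfl (hKB.trans hBl) hKB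
  have hmain := bitProb_exists_isCliqueColoring_le (V := Fin n) (ℓ := Nat.clog 2 n) (s := s)
    (K := ⌊B⌋₊) (by simpa using Nat.le_pow_clog (by norm_num) n)
    (Nat.clog_pos (by norm_num) hn) hs rfl h5 hexp (Nat.floor_pos.2 hB1) (by simpa using hK)
  refine (bitProb_mono fun ω hω => ?_).trans (hmain.trans ?_)
  -- A colouring with fewer colours is also one with `⌊B⌋₊` colours, so a single value of `K`
  -- suffices.
  · have hχ : (bitGraph ω).cliqueChromaticNumber ≤ ⌊B⌋₊ := Nat.le_floor (not_le.1 hω).le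
    obtain ⟨c, hc⟩ := (bitGraph ω).cliqueChromaticNumber_spec
    exact ⟨_, hc.comp_injective (Fin.castLE_injective hχ)⟩
  · gcongr
    have := log_le_clog n (by omega)
    rw [hs]; push_cast; linarith

/-! ### Vanishing error sequences and the conclusion -/

theorem bitProb_le_one {E : Type*} [Fintype E] [DecidableEq E] (A : (E → Bool) → Prop) :
    bitProb A ≤ 1 :=
  (bitProb_le_bitAvg (f := fun _ => 1) (fun _ => zero_le_one) fun _ _ => le_rfl).trans
    (bitAvg_const _).le

/-- Diagonalization: errors that vanish for each fixed `ε` vanish along some `ε = δ n → 0`. -/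
theorem exists_tendsto_zero_of_forall_pos (f : ℕ → ℝ → ℝ) (h0 : ∀ n ε, 0 ≤ f n ε)
    (h1 : ∀ n ε, f n ε ≤ 1) (hanti : ∀ᶠ n in atTop, Antitone (f n))
    (hlim : ∀ ε, 0 < ε → Tendsto (fun n => f n ε) atTop (𝓝 0)) :
    ∃ δ : ℕ → ℝ, Tendsto δ atTop (𝓝 0) ∧ Tendsto (fun n => f n (δ n)) atTop (𝓝 0) := by
  set A : ℕ → Set ℝ := fun n => {ε | 0 < ε ∧ f n ε ≤ ε} with hA
  have hbdd : ∀ n, BddBelow (A n) := fun n => ⟨0, fun ε hε => hε.1.le⟩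
  have hne : ∀ n, (A n).Nonempty := fun n => ⟨1, one_pos, h1 n 1⟩
  have hinf0 : ∀ n, 0 ≤ sInf (A n) := fun n => le_csInf (hne n) fun ε hε => hε.1.le
  have hinf : Tendsto (fun n => sInf (A n)) atTop (𝓝 0) := by
    refine tendsto_order.2 ⟨fun a ha => Eventually.of_forall fun n => ha.trans_le (hinf0 n),
      fun a ha => ?_⟩
    filter_upwards [(hlim (a / 2) (by linarith)).eventually_le_const (by linarith : 0 < a / 2)]
      with n hn
    exact (csInf_le (hbdd n) ⟨by linarith, hn⟩).trans_lt (by linarith)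
  -- The infimum need not be attained; moving `1 / (n + 1)` above it passes some member of `A n`,
  -- and monotonicity transfers the bound.
  have hδ : Tendsto (fun n : ℕ => sInf (A n) + 1 / ((n : ℝ) + 1)) atTop (𝓝 0) := by
    simpa using hinf.add tendsto_one_div_add_atTop_nhds_zero_nat
  refine ⟨_, hδ, squeeze_zero' (Eventually.of_forall fun n => h0 _ _) ?_ hδ⟩
  filter_upwards [hanti] with n hn
  obtain ⟨ε, hε, hlt⟩ := exists_lt_of_csInf_lt (hne n)
    (show sInf (A n) < sInf (A n) + 1 / ((n : ℝ) + 1) by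
      have : (0 : ℝ) < 1 / ((n : ℝ) + 1) := by positivity
      linarith)
  exact (hn hlt.le).trans (hε.2.trans hlt.le)

theorem whp_and {P Q : (n : ℕ) → SimpleGraph (Fin n) → Prop}
    (hP : Tendsto (fun n => bitProb fun ω : Sym2 (Fin n) → Bool => ¬ P n (bitGraph ω)) atTop (𝓝 0))
    (hQ : Tendsto (fun n => bitProb fun ω : Sym2 (Fin n) → Bool => ¬ Q n (bitGraph ω)) atTop (𝓝 0)) :
    Whp fun n G => P n G ∧ Q n G := by
  rw [whp_iff]
  have h := hP.add hQ
  rw [add_zero] at h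
  refine squeeze_zero (fun n => bitProb_nonneg _) (fun n => ?_) h
  exact (bitProb_mono fun ω hω => not_and_or.1 hω).trans (bitProb_or_le _ _)

theorem Whp.mono {P Q : (n : ℕ) → SimpleGraph (Fin n) → Prop} (hP : Whp P)
    (h : ∀ᶠ n in atTop, ∀ G, P n G → Q n G) : Whp Q := by
  rw [whp_iff] at hP ⊢
  refine squeeze_zero' (Eventually.of_forall fun n => bitProb_nonneg _) ?_ hP
  filter_upwards [h] with n hn
  exact bitProb_mono fun ω hω hP => hω (hn _ hP)

theorem theorem1 :
    (∃ δ₁ δ₂ : ℕ → ℝ, Tendsto δ₁ atTop (𝓝 0) ∧ Tendsto δ₂ atTop (𝓝 0) ∧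
      Whp (fun n G =>
        1 / 2 * Real.logb 2 (n : ℝ) - (3 + δ₁ n) * Real.logb 2 (Real.log (n : ℝ))
            ≤ (G.cliqueChromaticNumber : ℝ) ∧
        (G.cliqueChromaticNumber : ℝ)
            ≤ 1 / 2 * Real.logb 2 (n : ℝ)
              - (1 / 2 - δ₂ n) * Real.logb 2 (Real.log (n : ℝ)))) ∧
    (∃ a b : ℝ, 0 < a ∧ 0 < b ∧
      Whp (fun n G =>
        a * Real.log (Real.log (n : ℝ))
            ≤ 1 / 2 * Real.logb 2 (n : ℝ) - (G.cliqueChromaticNumber : ℝ) ∧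
        1 / 2 * Real.logb 2 (n : ℝ) - (G.cliqueChromaticNumber : ℝ)
            ≤ b * Real.log (Real.log (n : ℝ)))) ∧
    (∀ ε : ℝ, 0 < ε →
      Whp (fun n G =>
        (1 / 2 - ε) * Real.logb 2 (n : ℝ) ≤ (G.cliqueChromaticNumber : ℝ) ∧
        (G.cliqueChromaticNumber : ℝ) ≤ (1 / 2 + ε) * Real.logb 2 (n : ℝ))) := by
  have hL : ∀ᶠ n : ℕ in atTop, 0 ≤ Real.logb 2 (Real.log n) := by
    filter_upwards [tendsto_log_nat.eventually_ge_atTop 1] with n hn using logb_log_nonneg hn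
  have hlog2 := Real.log_pos (by norm_num : (1 : ℝ) < 2)
  -- The value `ε = 1/4` keeps both coefficients, `13/4` and `1/4`, positive, which suffices for the
  -- last two claims.
  have hquarter := whp_and (P := fun n G => 1 / 2 * Real.logb 2 n -
      (3 + 1 / 4) * Real.logb 2 (Real.log n) ≤ (G.cliqueChromaticNumber : ℝ))
    (Q := fun n G => (G.cliqueChromaticNumber : ℝ) ≤ 1 / 2 * Real.logb 2 n -
      (1 / 2 - 1 / 4) * Real.logb 2 (Real.log n))
    (tendsto_bitProb_lower (by norm_num : (0 : ℝ) < 1 / 4))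
    (tendsto_bitProb_upper (by norm_num : (0 : ℝ) < 1 / 4))
  refine ⟨?_, ?_, fun ε hε => ?_⟩
  · obtain ⟨δ₁, hδ₁, h₁⟩ := exists_tendsto_zero_of_forall_pos
      (fun n ε => bitProb fun ω : Sym2 (Fin n) → Bool =>
        ¬ (1 / 2 * Real.logb 2 n - (3 + ε) * Real.logb 2 (Real.log n) ≤
          ((bitGraph ω).cliqueChromaticNumber : ℝ)))
      (fun n ε => bitProb_nonneg _) (fun n ε => bitProb_le_one _)
      (by
        filter_upwards [hL] with n hn ε ε' hεε'
        refine bitProb_mono fun ω hω h => hω (le_trans ?_ h)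
        gcongr) (fun ε hε => tendsto_bitProb_lower hε)
    obtain ⟨δ₂, hδ₂, h₂⟩ := exists_tendsto_zero_of_forall_pos
      (fun n ε => bitProb fun ω : Sym2 (Fin n) → Bool =>
        ¬ (((bitGraph ω).cliqueChromaticNumber : ℝ) ≤
          1 / 2 * Real.logb 2 n - (1 / 2 - ε) * Real.logb 2 (Real.log n)))
      (fun n ε => bitProb_nonneg _) (fun n ε => bitProb_le_one _)
      (by
        filter_upwards [hL] with n hn ε ε' hεε'
        refine bitProb_mono fun ω hω h => hω (le_trans h ?_)
        gcongr) (fun ε hε => tendsto_bitProb_upper hε)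
    exact ⟨δ₁, δ₂, hδ₁, hδ₂, whp_and (P := fun n G => 1 / 2 * Real.logb 2 n -
      (3 + δ₁ n) * Real.logb 2 (Real.log n) ≤ (G.cliqueChromaticNumber : ℝ))
      (Q := fun n G => (G.cliqueChromaticNumber : ℝ) ≤ 1 / 2 * Real.logb 2 n -
      (1 / 2 - δ₂ n) * Real.logb 2 (Real.log n)) h₁ h₂⟩
  · refine ⟨1 / 4 / Real.log 2, 13 / 4 / Real.log 2, by positivity, by positivity,
      hquarter.mono (Eventually.of_forall fun n G h => ?_)⟩
    have e : ∀ c : ℝ, c / Real.log 2 * Real.log (Real.log n) =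
        c * Real.logb 2 (Real.log n) := fun c => by rw [Real.logb]; ring
    rw [e, e]
    constructor <;> linarith [h.1, h.2]
  · refine hquarter.mono ?_
    filter_upwards [hL, eventually_logb_log_le (c := ε / 4) (by positivity)] with n h1 h2 G h
    have h3 : 0 ≤ ε * Real.logb 2 n := by linarith
    constructor <;> linarith [h.1, h.2]
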